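/- A central processor (CP) communicates with one user through two cooperating base stations (BS 1 and BS 2). Let $C_1,C_2,C_{12},C_{21},P_1,P_2\ge 0$. A code of block length $n$ and rate $R$ works as follows. A message $w$, uniform on a set of $\lceil 2^{nR}\rceil$ messages, is mapped by the CP to an index for BS 1, from a set of size $\lfloor 2^{nC_1}\rfloor$, and an index for BS 2, from a set of size $\lfloor 2^{nC_2}\rfloor$. The base stations then confer over noiseless links in finitely many rounds: in every round each sends the other a symbol that depends on its own index and on the symbols it received in earlier rounds. The product of the alphabet sizes over all rounds is at most $2^{nC_{12}}$ for the link into BS 1 (from BS 2) and at most $2^{nC_{21}}$ for the link into BS 2 (from BS 1). Each BS $k$ then forms its channel input $X_k^n\in\mathbb R^n$ from its index and the symbols it has received, subject to $\frac1n\sum_{i=1}^n\mathbb E[X_{k,i}^2]\le P_k$. The user observes $Y_i=X_{1,i}+X_{2,i}+Z_i$, $i=1,\dots,n$, with $Z_i$ i.i.d. $\mathcal N(0,1)$, and decodes $w$. The rate $R$ is achievable if there are such codes for all $n$ whose average error probability tends to $0$ as $n\to\infty$. **Proposition.** If $R$ is achievable, then there are $\rho\in[0,1]$ and $\rho_1,\rho_2\in[0,1)$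 with $\Delta:=1-\rho^2-\rho_1^2-\rho_2^2+2\rho\rho_1\rho_2\ge 0$ such that for every $N\ge 0$ $$ R\le\min\begin{cases} C_1+C_2,\\ C_1+C_{12}+\frac12\log\dfrac{1-\rho_1^2+\Delta P_2}{1-\rho_1^2},\\ C_2+C_{21}+\frac12\log\dfrac{1-\rho_2^2+\Delta P_1}{1-\rho_2^2},\\ \frac12\log\left(1+P_1+P_2+2\rho\sqrt{P_1P_2}\right),\\ C_{12}+C_{21}+\frac12\log\varphi,\\ \frac12\left[C_1+C_2+C_{12}+C_{21}+\frac12\log\dfrac{\varphi\,\phi_1\,\phi_2}{(1+N)(1-\rho_1^2)(1-\rho_2^2)(N+\varphi)}\right], \end{cases} $$ where $\log$ is to base $2$, $\varphi=1+(1-\rho_1^2)P_1+(1-\rho_2^2)P_2+2(\rho-\rho_1\rho_2)\sqrt{P_1P_2}$, $\phi_1=(1-\rho_1^2)(1+N)+\Delta P_2$ and $\phi_2=(1-\rho_2^2)(1+N)+\Delta P_1$. -/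

import Mathlib

open MeasureTheory ProbabilityTheory Filter Topology

noncomputable section

namespace CRAN

/-- A code of block length `n` with `M` messages for a cloud processor (CP) serving one user through
two cooperating base stations (BS).

* The CP maps the message to an index in `Fin L₁` for BS 1 and an index in `Fin L₂` for BS 2.
* The BSs then confer over noiseless links in finitely many rounds. In round `k` BS 1 sends a symbol of
  `Fin (size₂₁ k)` to BS 2, and BS 2 sends a symbol of `Fin (size₁₂ k)` to BS 1; each depends on
  the index received from the CP and on the symbols received in the earlier rounds. The link into BS 1
  carries at most `L₁₂` distinct symbol sequences, the link into BS 2 at most `L₂₁`.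
  One round is the special case of a simple exchange of one cooperation message each way.
* Each BS forms its channel input from its index and all the symbols it has received.
* The user decodes from the channel output. -/
structure Code (n M L₁ L₂ L₁₂ L₂₁ : ℕ) where
  cloud₁ : Fin M → Fin L₁
  cloud₂ : Fin M → Fin L₂
  rounds : ℕ
  size₁₂ : Fin rounds → ℕ
  size₂₁ : Fin rounds → ℕ
  prod_size₁₂_le : ∏ k, size₁₂ k ≤ L₁₂
  prod_size₂₁_le : ∏ k, size₂₁ k ≤ L₂₁
  /-- what BS 1 sends in round `k` -/
  confer₁ : (k : Fin rounds) → Fin L₁ → ((j : Fin rounds) → j < k → Fin (size₁₂ j)) → Fin (size₂₁ k)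
  /-- what BS 2 sends in round `k` -/
  confer₂ : (k : Fin rounds) → Fin L₂ → ((j : Fin rounds) → j < k → Fin (size₂₁ j)) → Fin (size₁₂ k)
  enc₁ : Fin L₁ → ((k : Fin rounds) → Fin (size₁₂ k)) → Fin n → ℝ
  enc₂ : Fin L₂ → ((k : Fin rounds) → Fin (size₂₁ k)) → Fin n → ℝ
  dec : (Fin n → ℝ) → Fin M
  measurable_dec : Measurable dec

namespace Code

variable {n M L₁ L₂ L₁₂ L₂₁ : ℕ} (c : Code n M L₁ L₂ L₁₂ L₂₁)

/-- The pair (symbol received by BS 1, symbol received by BS 2) in round `k` of the conference, when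
the CP has sent the indices `l₁` and `l₂`. -/
def transcript (l₁ : Fin L₁) (l₂ : Fin L₂) (k : Fin c.rounds) :
    Fin (c.size₁₂ k) × Fin (c.size₂₁ k) :=
  (c.confer₂ k l₂ (fun j _ => (transcript l₁ l₂ j).2),
   c.confer₁ k l₁ (fun j _ => (transcript l₁ l₂ j).1))
termination_by k

/-- The channel input sequence of BS 1 for the message `w`. -/
def input₁ (w : Fin M) : Fin n → ℝ :=
  c.enc₁ (c.cloud₁ w) (fun k => (c.transcript (c.cloud₁ w) (c.cloud₂ w) k).1)

/-- The channel input sequence of BS 2 for the message `w`. -/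
def input₂ (w : Fin M) : Fin n → ℝ :=
  c.enc₂ (c.cloud₂ w) (fun k => (c.transcript (c.cloud₁ w) (c.cloud₂ w) k).2)

/-- Average power constraint `(1/n) ∑ᵢ E[X_{k,i}²] ≤ P_k`, the message being uniform. -/
def PowerConstraint (P₁ P₂ : ℝ) : Prop :=
  (∑ w, ∑ i, (c.input₁ w i) ^ 2) / M ≤ n * P₁ ∧ (∑ w, ∑ i, (c.input₂ w i) ^ 2) / M ≤ n * P₂

/-- Average error probability over the channel `Y = X₁ + X₂ + Z` with i.i.d. noise `Z ∼ 𝒩(0,1)`, the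
message being uniform. -/
def errorProb : ℝ :=
  (∑ w, (Measure.pi fun _ : Fin n => gaussianReal 0 1).real
    {z | c.dec (c.input₁ w + c.input₂ w + z) ≠ w}) / M

end Code

/-- The rate `R` (in bits per channel use) is achievable: there are codes of all block lengths, with
`⌈2^{nR}⌉` messages, links of `nC` bits and powers `P₁`, `P₂`, with vanishing error probability.
`C₁₂` is the capacity of the link into BS 1 from BS 2, `C₂₁` of the link into BS 2 from BS 1. -/
def Achievable (C₁ C₂ C₁₂ C₂₁ P₁ P₂ R : ℝ) : Prop :=
  ∃ c : (n : ℕ) → Code n ⌈(2 : ℝ) ^ (n * R)⌉₊ ⌊(2 : ℝ) ^ (n * C₁)⌋₊ ⌊(2 : ℝ) ^ (n * C₂)⌋₊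
      ⌊(2 : ℝ) ^ (n * C₁₂)⌋₊ ⌊(2 : ℝ) ^ (n * C₂₁)⌋₊,
    (∀ n, (c n).PowerConstraint P₁ P₂) ∧ Tendsto (fun n => (c n).errorProb) atTop (𝓝 0)

/-- `1 - ρ² - ρ₁² - ρ₂² + 2ρρ₁ρ₂`, the determinant of the correlation matrix. -/
def corrDet (ρ ρ₁ ρ₂ : ℝ) : ℝ := 1 - ρ ^ 2 - ρ₁ ^ 2 - ρ₂ ^ 2 + 2 * ρ * ρ₁ * ρ₂

/-- `ϕ₁(ρ,ρ₁,ρ₂,P)` -/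
def phi₁ (N ρ ρ₁ ρ₂ P : ℝ) : ℝ := (1 - ρ₁ ^ 2) * (1 + N) + corrDet ρ ρ₁ ρ₂ * P

/-- `ϕ₂(ρ,ρ₁,ρ₂,P)` -/
def phi₂ (N ρ ρ₁ ρ₂ P : ℝ) : ℝ := (1 - ρ₂ ^ 2) * (1 + N) + corrDet ρ ρ₁ ρ₂ * P

/-- `φ(ρ,ρ₁,ρ₂,P₁,P₂)` -/
def varphi (ρ ρ₁ ρ₂ P₁ P₂ : ℝ) : ℝ :=
  1 + (1 - ρ₁ ^ 2) * P₁ + (1 - ρ₂ ^ 2) * P₂ + 2 * (ρ - ρ₁ * ρ₂) * √(P₁ * P₂)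

end CRAN

end

/-! The converse is a genie argument. Let W be the message, x the sum of the two inputs, Y = x + Z
with noise variance τ, and S a function of W. Up to the factor M (the number of messages), `logMix τ
x S` is H(W | Y, S) - h(Z) in nats, so every entropy inequality needed becomes an inequality between
values of `logMix`. Each nontrivial one is Gibbs' inequality (`sum_integral_log_nonpos`) for a
suitable ratio of densities.

Fano bounds `logMix` above for every S (`logMix_le_of_decoder`). Gaussian maximum entropy bounds it
below through the alphabet size of S and the error of any estimate of x from S
(`le_logMix_of_center`). Together they give one rate bound for each choice of S: both CP indices,
the view of one base station after the conference, the conference T, or nothing.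

The last bound takes both views S₁, S₂ at once and observes x in the larger noise 1 + N. Since T is
a function of each view, I(S₁; S₂ | T, Y) ≥ 0 (`logMix_add_logMix_le`). The return to noise 1 is
exact for the pair (S₁, S₂), which determines x (`logMix_of_factors`), and for T it costs at most
what it would for a Gaussian, because Gaussian noise is worst for a Gaussian input
(`logMix_add_le`).

The errors are expressed through the covariances k₁, k₂, k of the inputs given T and the powers q₁,
q₂ of their conditional means (`Code.feasible`). Compactness gives limiting parameters valid for R
itself (`Achievable.feasible`). Finally ρ₁, ρ₂ measure the share of each power carried by the
conditional mean, and ρ adds the residual correlation to ρ₁ρ₂ (`Feasible.exists_correlations`). None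
of these parameters depends on N. -/

noncomputable section

open scoped NNReal ENNReal

/-! ### White Gaussian noise and Gibbs' inequality. -/

namespace CRAN

/-- Squared Euclidean norm on `Fin n → ℝ`. -/
def normSq {n : ℕ} (z : Fin n → ℝ) : ℝ := ∑ i, z i ^ 2

/-- White Gaussian noise of variance `τ` per coordinate. -/
def noise (n : ℕ) (τ : ℝ≥0) : Measure (Fin n → ℝ) := Measure.pi fun _ => gaussianReal 0 τ

instance (n : ℕ) (τ : ℝ≥0) : IsProbabilityMeasure (noise n τ) := by
  unfold noise; infer_instance

/-- Density of `noise n τ`. -/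
def noiseDensity {n : ℕ} (τ : ℝ≥0) (z : Fin n → ℝ) : ℝ := ∏ i, gaussianPDFReal 0 τ (z i)

variable {n : ℕ} {τ : ℝ≥0}

lemma normSq_nonneg (z : Fin n → ℝ) : 0 ≤ normSq z := Finset.sum_nonneg fun _ _ => sq_nonneg _

lemma normSq_add_le (x z : Fin n → ℝ) : normSq (x + z) ≤ 2 * normSq x + 2 * normSq z := by
  simp only [normSq, Finset.mul_sum, ← Finset.sum_add_distrib]
  refine Finset.sum_le_sum fun i _ => ?_
  simp only [Pi.add_apply]
  nlinarith [sq_nonneg (x i - z i)]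

lemma normSq_sub_le (x z : Fin n → ℝ) : normSq (x - z) ≤ 2 * normSq x + 2 * normSq z := by
  have := normSq_add_le x (-z)
  simpa [normSq, sub_eq_add_neg] using this

@[fun_prop]
lemma measurable_normSq : Measurable (normSq : (Fin n → ℝ) → ℝ) := by
  unfold normSq; fun_prop

lemma noiseDensity_pos (hτ : τ ≠ 0) (z : Fin n → ℝ) : 0 < noiseDensity τ z :=
  Finset.prod_pos fun _ _ => gaussianPDFReal_pos _ _ _ hτ

lemma noiseDensity_nonneg (z : Fin n → ℝ) : 0 ≤ noiseDensity τ z :=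
  Finset.prod_nonneg fun _ _ => gaussianPDFReal_nonneg _ _ _

@[fun_prop]
lemma measurable_noiseDensity : Measurable (noiseDensity τ : (Fin n → ℝ) → ℝ) := by
  unfold noiseDensity
  exact Finset.measurable_prod _ fun i _ =>
    (measurable_gaussianPDFReal 0 τ).comp (measurable_pi_apply i)

lemma log_noiseDensity (hτ : τ ≠ 0) (z : Fin n → ℝ) :
    Real.log (noiseDensity τ z) =
      -(n / 2 * Real.log (2 * Real.pi * τ)) - normSq z / (2 * τ) := by
  have hτ' : (0 : ℝ) < τ := by positivity
  have hpos : (0 : ℝ) < 2 * Real.pi * τ := by positivity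
  unfold noiseDensity
  rw [Real.log_prod fun i _ => (gaussianPDFReal_pos 0 τ (z i) hτ).ne']
  have : ∀ i, Real.log (gaussianPDFReal 0 τ (z i)) =
      -(1 / 2 * Real.log (2 * Real.pi * τ)) - z i ^ 2 / (2 * τ) := fun i => by
    rw [gaussianPDFReal, Real.log_mul (by positivity) (by positivity), Real.log_inv,
      Real.log_sqrt hpos.le, Real.log_exp]
    simp only [sub_zero]
    ring
  simp only [this, normSq, Finset.sum_sub_distrib, Finset.sum_const, Finset.card_univ,
    Fintype.card_fin, Finset.sum_div]
  simp; ring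

lemma noise_eq_withDensity (hτ : τ ≠ 0) :
    noise n τ = volume.withDensity fun z => ENNReal.ofReal (noiseDensity τ z) := by
  refine Measure.pi_eq fun s hs => ?_
  rw [withDensity_apply _ (MeasurableSet.univ_pi hs), volume_pi, Measure.restrict_pi_pi,
    ← ofReal_integral_eq_lintegral_ofReal]
  · unfold noiseDensity
    rw [integral_fintype_prod_eq_prod (fun (_ : Fin n) x => gaussianPDFReal 0 τ x),
      ENNReal.ofReal_prod_of_nonneg
        fun i _ => integral_nonneg fun x => gaussianPDFReal_nonneg _ _ _]
    exact Finset.prod_congr rfl fun i _ => (gaussianReal_apply_eq_integral 0 hτ (s i)).symm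
  · unfold noiseDensity
    exact Integrable.fintype_prod fun i => (integrable_gaussianPDFReal 0 τ).restrict
  · exact ae_of_all _ fun z => noiseDensity_nonneg z

lemma lintegral_noise (hτ : τ ≠ 0) (x : Fin n → ℝ) {f : (Fin n → ℝ) → ℝ≥0∞}
    (hf : Measurable f) :
    ∫⁻ z, f (x + z) ∂noise n τ = ∫⁻ y, ENNReal.ofReal (noiseDensity τ (y - x)) * f y := by
  rw [noise_eq_withDensity hτ, lintegral_withDensity_eq_lintegral_mul _ (by fun_prop) (by fun_prop),
    ← lintegral_add_left_eq_self (fun y => ENNReal.ofReal (noiseDensity τ (y - x)) * f y) x]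
  simp

lemma lintegral_noiseDensity (hτ : τ ≠ 0) (x : Fin n → ℝ) :
    ∫⁻ y, ENNReal.ofReal (noiseDensity τ (y - x)) = 1 := by
  simpa using (lintegral_noise hτ x (f := fun _ => 1) measurable_const).symm

/-- Independent white noises add up to white noise. -/
lemma map_add_noise_prod (τ₁ τ₂ : ℝ≥0) :
    ((noise n τ₁).prod (noise n τ₂)).map (fun p => p.1 + p.2) = noise n (τ₁ + τ₂) := by
  have h := measurePreserving_arrowProdEquivProdArrow ℝ ℝ (Fin n)
    (fun _ => gaussianReal 0 τ₁) (fun _ => gaussianReal 0 τ₂)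
  unfold noise
  rw [← h.map_eq, Measure.map_map (by fun_prop) h.measurable]
  have h2 := Measure.pi_map_pi (ι := Fin n)
    (μ := fun _ => (gaussianReal 0 τ₁).prod (gaussianReal 0 τ₂))
    (f := fun _ (p : ℝ × ℝ) => p.1 + p.2) (fun i => by fun_prop)
  have h3 : ((gaussianReal 0 τ₁).prod (gaussianReal 0 τ₂)).map (fun p => p.1 + p.2) =
      gaussianReal 0 (τ₁ + τ₂) := by
    simpa [Measure.conv] using gaussianReal_conv_gaussianReal (m₁ := 0) (m₂ := 0) (v₁ := τ₁) (v₂ := τ₂)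
  simp only [h3] at h2
  rw [← h2]
  rfl

lemma integrable_coord_sq (τ : ℝ≥0) (i : Fin n) :
    Integrable (fun z : Fin n → ℝ => z i ^ 2) (noise n τ) := by
  unfold noise
  exact integrable_comp_eval (μ := fun _ : Fin n => gaussianReal 0 τ) (i := i)
    (f := fun x : ℝ => x ^ 2)
    (memLp_id_gaussianReal (μ := 0) (v := τ) 2).integrable_sq

lemma integrable_coord (τ : ℝ≥0) (i : Fin n) :
    Integrable (fun z : Fin n → ℝ => z i) (noise n τ) := by
  unfold noise
  exact integrable_comp_eval (μ := fun _ : Fin n => gaussianReal 0 τ) (i := i)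
    (f := fun x : ℝ => x)
    ((memLp_id_gaussianReal (μ := 0) (v := τ) 1).integrable (by simp))

lemma integral_coord (τ : ℝ≥0) (i : Fin n) : ∫ z : Fin n → ℝ, z i ∂noise n τ = 0 := by
  have := integral_comp_eval (μ := fun _ : Fin n => gaussianReal 0 τ) (i := i)
    (f := fun x : ℝ => x) (by fun_prop)
  rw [noise, this, integral_id_gaussianReal]

lemma integral_coord_sq (τ : ℝ≥0) (i : Fin n) : ∫ z : Fin n → ℝ, z i ^ 2 ∂noise n τ = τ := by
  have := integral_comp_eval (μ := fun _ : Fin n => gaussianReal 0 τ) (i := i)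
    (f := fun x : ℝ => x ^ 2) (by fun_prop)
  rw [noise, this]
  have h2 := variance_fun_id_gaussianReal (μ := 0) (v := τ)
  rwa [variance_of_integral_eq_zero (by fun_prop) (by simp)] at h2

lemma integrable_normSq (τ : ℝ≥0) : Integrable (normSq : (Fin n → ℝ) → ℝ) (noise n τ) :=
  integrable_finsetSum _ fun i _ => integrable_coord_sq τ i

lemma integrable_normSq_affine (τ : ℝ≥0) (a : ℝ) (x : Fin n → ℝ) :
    Integrable (fun z => normSq (x + a • z)) (noise n τ) := by
  refine integrable_finsetSum _ fun i _ => ?_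
  simp only [Pi.add_apply, Pi.smul_apply, smul_eq_mul]
  have : (fun z : Fin n → ℝ => (x i + a * z i) ^ 2) =
      fun z => x i ^ 2 + 2 * x i * a * z i + a ^ 2 * z i ^ 2 := by ext; ring
  rw [this]
  exact ((integrable_const _).add ((integrable_coord τ i).const_mul _)).add
    ((integrable_coord_sq τ i).const_mul _)

lemma integral_normSq_affine (τ : ℝ≥0) (a : ℝ) (x : Fin n → ℝ) :
    ∫ z, normSq (x + a • z) ∂noise n τ = normSq x + a ^ 2 * (n * τ) := by
  have h : ∀ i, (fun z : Fin n → ℝ => (x i + a * z i) ^ 2) =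
      fun z => x i ^ 2 + 2 * x i * a * z i + a ^ 2 * z i ^ 2 := fun i => by ext; ring
  have h1 : ∀ i, Integrable (fun z : Fin n → ℝ => x i ^ 2 + 2 * x i * a * z i) (noise n τ) :=
    fun i => (integrable_const _).add ((integrable_coord τ i).const_mul _)
  have h2 : ∀ i, Integrable (fun z : Fin n → ℝ => a ^ 2 * z i ^ 2) (noise n τ) :=
    fun i => (integrable_coord_sq τ i).const_mul _
  simp only [normSq, Pi.add_apply, Pi.smul_apply, smul_eq_mul]
  rw [integral_finsetSum]
  · have : ∀ i, ∫ z : Fin n → ℝ, (x i + a * z i) ^ 2 ∂noise n τ = x i ^ 2 + a ^ 2 * τ := fun i => by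
      rw [h, integral_add (h1 i) (h2 i),
        integral_add (integrable_const _) ((integrable_coord τ i).const_mul _),
        integral_const_mul, integral_const_mul, integral_coord, integral_coord_sq]
      simp
    simp only [this, Finset.sum_add_distrib]
    simp; ring
  · intro i _
    rw [h]
    exact (h1 i).add (h2 i)

/-- Measurable functions of at most quadratic growth are integrable against shifted noise. -/
lemma integrable_of_quadratic_bound (τ : ℝ≥0) (x : Fin n → ℝ) {f : (Fin n → ℝ) → ℝ}
    (hf : Measurable f) {A B : ℝ} (hB : 0 ≤ B) (h : ∀ y, |f y| ≤ A + B * normSq y) :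
    Integrable (fun z => f (x + z)) (noise n τ) := by
  have hd : Integrable (fun z : Fin n → ℝ => A + B * (2 * normSq x + 2 * normSq z)) (noise n τ) :=
    (integrable_const _).add (((integrable_const _).add ((integrable_normSq τ).const_mul 2)).const_mul B)
  refine hd.mono' (by exact (hf.comp (measurable_const_add x)).aestronglyMeasurable) (ae_of_all _ fun z => (h _).trans ?_)
  gcongr
  exact normSq_add_le x z

/-- Gibbs' inequality, averaged over a finite family. -/
lemma sum_integral_log_nonpos {ι Ω : Type*} [Fintype ι] [MeasurableSpace Ω] (μ : Measure Ω)
    [IsProbabilityMeasure μ] {r : ι → Ω → ℝ} (hpos : ∀ i ω, 0 < r i ω)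
    (hm : ∀ i, Measurable (r i)) (hlogint : ∀ i, Integrable (fun ω => Real.log (r i ω)) μ)
    (hle : ∑ i, ∫⁻ ω, ENNReal.ofReal (r i ω) ∂μ ≤ Fintype.card ι) :
    ∑ i, ∫ ω, Real.log (r i ω) ∂μ ≤ 0 := by
  have hfin : ∀ i, ∫⁻ ω, ENNReal.ofReal (r i ω) ∂μ ≠ ∞ := fun i =>
    ((Finset.single_le_sum (f := fun i => ∫⁻ ω, ENNReal.ofReal (r i ω) ∂μ)
      (fun _ _ => zero_le) (Finset.mem_univ i)).trans_lt
        (hle.trans_lt (ENNReal.natCast_lt_top _))).ne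
  have hri : ∀ i, Integrable (r i) μ := fun i =>
    ⟨(hm i).aestronglyMeasurable, by
      rw [hasFiniteIntegral_iff_ofReal (ae_of_all _ fun ω => (hpos i ω).le)]
      exact (hfin i).lt_top⟩
  have h1 : ∀ i, ∫ ω, Real.log (r i ω) ∂μ ≤ ∫ ω, r i ω ∂μ - 1 := fun i => by
    calc _ ≤ ∫ ω, (r i ω - 1) ∂μ := integral_mono (hlogint i) ((hri i).sub (integrable_const _))
          fun ω => Real.log_le_sub_one_of_pos (hpos i ω)
      _ = _ := by rw [integral_sub (hri i) (integrable_const _)]; simp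
  have h2 : ∑ i, ∫ ω, r i ω ∂μ ≤ Fintype.card ι := by
    have : ∀ i, ∫ ω, r i ω ∂μ = (∫⁻ ω, ENNReal.ofReal (r i ω) ∂μ).toReal := fun i =>
      integral_eq_lintegral_of_nonneg_ae (ae_of_all _ fun ω => (hpos i ω).le)
        (hm i).aestronglyMeasurable
    simp only [this]
    rw [← ENNReal.toReal_sum fun i _ => hfin i]
    exact ENNReal.toReal_le_of_le_ofReal (by positivity) (by simpa using hle)
  calc _ ≤ ∑ i, (∫ ω, r i ω ∂μ - 1) := Finset.sum_le_sum fun i _ => h1 i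
    _ ≤ 0 := by simp only [Finset.sum_sub_distrib]; simpa using h2

end CRAN
end

/-! ### Gaussian mixtures over the fibers of a side information, and Fano's inequality. -/

noncomputable section

open scoped NNReal ENNReal

namespace CRAN

variable {n : ℕ} {τ : ℝ≥0}

lemma integral_log_noiseDensity (hτ : τ ≠ 0) (θ : ℝ≥0) (x : Fin n → ℝ) (a : ℝ) :
    ∫ z, Real.log (noiseDensity τ (x + a • z)) ∂noise n θ =
      -(n / 2 * Real.log (2 * Real.pi * τ)) - (normSq x + a ^ 2 * (n * θ)) / (2 * τ) := by
  simp only [log_noiseDensity hτ]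
  rw [integral_sub (integrable_const _) ((integrable_normSq_affine θ a x).div_const _),
    integral_div, integral_normSq_affine]
  simp

lemma integrable_log_noiseDensity (hτ : τ ≠ 0) (θ : ℝ≥0) (x : Fin n → ℝ) (a : ℝ) :
    Integrable (fun z => Real.log (noiseDensity τ (x + a • z))) (noise n θ) := by
  simp only [log_noiseDensity hτ]
  exact (integrable_const _).sub ((integrable_normSq_affine θ a x).div_const _)

section Fibers

variable {ι σ : Type*} [Fintype ι] [DecidableEq σ]

/-- Within a fiber the normalised weights sum to 1, or to 0 if the fiber is empty or carries no
weight (division by zero gives 0); hence only an inequality. It disposes of the denominator `mix` in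
the ratios fed to Gibbs' inequality. -/
lemma sum_mul_div_fiber_le [Fintype σ] (S : ι → σ) {g : ι → ℝ} (hg : ∀ w, 0 ≤ g w) {q : σ → ℝ}
    (hq : ∀ s, 0 ≤ q s) :
    ∑ w, g w * (q (S w) / ∑ w' with S w' = S w, g w') ≤ ∑ s, q s := by
  rw [← Finset.sum_fiberwise Finset.univ S]
  refine Finset.sum_le_sum fun s _ => ?_
  have : ∑ w with S w = s, g w * (q (S w) / ∑ w' with S w' = S w, g w') =
      (∑ w with S w = s, g w) * (q s / ∑ w' with S w' = s, g w') := by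
    rw [Finset.sum_mul]
    refine Finset.sum_congr rfl fun w hw => ?_
    rw [(Finset.mem_filter.1 hw).2]
  rw [this]
  rcases eq_or_lt_of_le (Finset.sum_nonneg fun w (_ : w ∈ Finset.univ.filter (S · = s)) => hg w) with h | h
  · rw [← h]; simpa using hq s
  · rw [mul_div_cancel₀ _ h.ne']

/-- Nonnegativity of conditional mutual information, in the form needed for Gibbs' inequality. -/
lemma sum_mul_fiber_ratio_le {σ₁ σ₂ ρ : Type*} [DecidableEq σ₁] [DecidableEq σ₂] [DecidableEq ρ]
    (S₁ : ι → σ₁) (S₂ : ι → σ₂) (T : ι → ρ) (h₁ : ∀ w w', S₁ w = S₁ w' → T w = T w')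
    (h₂ : ∀ w w', S₂ w = S₂ w' → T w = T w') {g : ι → ℝ} (hg : ∀ w, 0 < g w) :
    ∑ w, g w * ((∑ u with S₁ u = S₁ w, g u) * (∑ v with S₂ v = S₂ w, g v) /
      ((∑ u with T u = T w, g u) * ∑ u with (S₁ u, S₂ u) = (S₁ w, S₂ w), g u)) ≤ ∑ w, g w := by
  set A : ι → ℝ := fun w => ∑ u with T u = T w, g u
  set D : σ₁ × σ₂ → ℝ := fun s => ∑ u with (S₁ u, S₂ u) = s, g u
  have hD : ∀ s, 0 ≤ D s := fun s => Finset.sum_nonneg fun _ _ => (hg _).le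
  have hA : ∀ w, 0 < A w := fun w =>
    Finset.sum_pos (fun _ _ => hg _) ⟨w, by simp⟩
  have hexp : ∀ w, g w * ((∑ u with S₁ u = S₁ w, g u) * (∑ v with S₂ v = S₂ w, g v) /
      (A w * D (S₁ w, S₂ w))) = ∑ u, ∑ v, g u * g v *
        (if (S₁ w, S₂ w) = (S₁ u, S₂ v) then g w / (A w * D (S₁ w, S₂ w)) else 0) := fun w => by
    rw [Finset.sum_filter, Finset.sum_filter, Finset.sum_mul_sum, Finset.sum_div, Finset.mul_sum]
    refine Finset.sum_congr rfl fun u _ => ?_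
    rw [Finset.sum_div, Finset.mul_sum]
    refine Finset.sum_congr rfl fun v _ => ?_
    by_cases hu : S₁ u = S₁ w <;> by_cases hv : S₂ v = S₂ w
    · simp [hu, hv]; ring
    · simp [hu, hv, Ne.symm hv]
    · simp [hu, hv, Ne.symm hu]
    · simp [hu, hv, Ne.symm hu]
  -- For a fixed pair (u, v) the sum over w runs over one fiber of (S₁, S₂), whose total weight is
  -- the `D` in the denominator, leaving 1 / A u. A nonempty fiber forces T u = T w = T v.
  have hin : ∀ u v, ∑ w, (if (S₁ w, S₂ w) = (S₁ u, S₂ v) then g w / (A w * D (S₁ w, S₂ w)) else 0)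
      ≤ if T v = T u then 1 / A u else 0 := fun u v => by
    by_cases hT : T v = T u
    · rw [if_pos hT, ← Finset.sum_filter]
      have : ∀ w ∈ Finset.univ.filter (fun w => (S₁ w, S₂ w) = (S₁ u, S₂ v)),
          g w / (A w * D (S₁ w, S₂ w)) = g w / (A u * D (S₁ u, S₂ v)) := fun w hw => by
        have hw' := (Finset.mem_filter.1 hw).2
        have : A w = A u := by
          simp only [A]; rw [h₁ w u (Prod.ext_iff.1 hw').1]
        rw [this, hw']
      rw [Finset.sum_congr rfl this, ← Finset.sum_div]
      change D (S₁ u, S₂ v) / _ ≤ _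
      rcases (hD (S₁ u, S₂ v)).eq_or_lt with h | h
      · rw [← h]; simpa using (hA u).le
      · rw [mul_comm (A u), div_mul_cancel_left₀ h.ne', one_div]
    · rw [if_neg hT]
      refine (Finset.sum_eq_zero fun w _ => if_neg fun h => hT ?_).le
      rw [← h₁ w u (Prod.ext_iff.1 h).1, ← h₂ w v (Prod.ext_iff.1 h).2]
  calc _ = ∑ w, ∑ u, ∑ v, g u * g v *
        (if (S₁ w, S₂ w) = (S₁ u, S₂ v) then g w / (A w * D (S₁ w, S₂ w)) else 0) :=
        Finset.sum_congr rfl fun w _ => hexp w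
    _ = ∑ u, ∑ v, g u * g v * ∑ w,
        (if (S₁ w, S₂ w) = (S₁ u, S₂ v) then g w / (A w * D (S₁ w, S₂ w)) else 0) := by
        rw [Finset.sum_comm]
        refine Finset.sum_congr rfl fun u _ => ?_
        rw [Finset.sum_comm]
        exact Finset.sum_congr rfl fun v _ => (Finset.mul_sum ..).symm
    _ ≤ ∑ u, ∑ v, g u * g v * (if T v = T u then 1 / A u else 0) := by
        gcongr with u _ v _
        · exact mul_nonneg (hg u).le (hg v).le
        · exact hin u v
    _ = ∑ u, g u := by
        refine Finset.sum_congr rfl fun u _ => ?_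
        have : ∀ v, g u * g v * (if T v = T u then 1 / A u else 0) =
            g u / A u * (if T v = T u then g v else 0) := fun v => by split_ifs <;> ring
        simp only [this]
        rw [← Finset.mul_sum, ← Finset.sum_filter]
        exact div_mul_cancel₀ _ (hA u).ne'

/-- Unnormalised density of the noisy observation of `x w`, over the `w` with `S w = s`. -/
def mix (τ : ℝ≥0) (x : ι → Fin n → ℝ) (S : ι → σ) (s : σ) (y : Fin n → ℝ) : ℝ :=
  ∑ w with S w = s, noiseDensity τ (y - x w)

/-- Sum over `w` of the expected logarithm of the unnormalised density of the fiber of `w`, observed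
in noise of variance `τ`. -/
def logMix (τ : ℝ≥0) (x : ι → Fin n → ℝ) (S : ι → σ) : ℝ :=
  ∑ w, ∫ z, Real.log (mix τ x S (S w) (x w + z)) ∂noise n τ

variable (x : ι → Fin n → ℝ) (S : ι → σ)

lemma mix_nonneg (s : σ) (y : Fin n → ℝ) : 0 ≤ mix τ x S s y :=
  Finset.sum_nonneg fun _ _ => noiseDensity_nonneg _

lemma noiseDensity_le_mix (w : ι) (y : Fin n → ℝ) :
    noiseDensity τ (y - x w) ≤ mix τ x S (S w) y :=
  Finset.single_le_sum (f := fun w => noiseDensity τ (y - x w))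
    (fun _ _ => noiseDensity_nonneg _) (by simp)

lemma mix_pos (hτ : τ ≠ 0) (w : ι) (y : Fin n → ℝ) : 0 < mix τ x S (S w) y :=
  (noiseDensity_pos hτ _).trans_le (noiseDensity_le_mix x S w y)

@[fun_prop]
lemma measurable_mix (s : σ) : Measurable (mix τ x S s) := by
  unfold mix; fun_prop

lemma noiseDensity_le_exp (hτ : τ ≠ 0) (z : Fin n → ℝ) :
    noiseDensity τ z ≤ Real.exp (-(n / 2 * Real.log (2 * Real.pi * τ))) := by
  rw [← Real.log_le_iff_le_exp (noiseDensity_pos hτ z), log_noiseDensity hτ]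
  have : 0 ≤ normSq z / (2 * τ) := div_nonneg (normSq_nonneg z) (by positivity)
  linarith

/-- From above, every component is at most the peak of the Gaussian density. From below, the mixture
dominates its component `w`, whose logarithm is quadratic. Quadratic growth is what makes
log-densities integrable under any shifted noise. -/
lemma abs_log_mix_le (hτ : τ ≠ 0) (w : ι) (y : Fin n → ℝ) :
    |Real.log (mix τ x S (S w) y)| ≤
      (Real.log (Fintype.card ι) + |n / 2 * Real.log (2 * Real.pi * τ)| + normSq (x w) / τ) +
        1 / τ * normSq y := by
  have hτ' : (0 : ℝ) < τ := by positivity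
  have hι : (1 : ℝ) ≤ Fintype.card ι := by
    exact_mod_cast Fintype.card_pos_iff.2 ⟨w⟩
  have hlog := Real.log_nonneg hι
  have h1 : 0 ≤ normSq (x w) / τ := div_nonneg (normSq_nonneg _) hτ'.le
  have h2 : 0 ≤ 1 / τ * normSq y := mul_nonneg (by positivity) (normSq_nonneg _)
  have hup : Real.log (mix τ x S (S w) y) ≤
      Real.log (Fintype.card ι) - n / 2 * Real.log (2 * Real.pi * τ) := by
    have : mix τ x S (S w) y ≤
        Fintype.card ι * Real.exp (-(n / 2 * Real.log (2 * Real.pi * τ))) := by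
      calc _ ≤ ∑ w, noiseDensity τ (y - x w) :=
            Finset.sum_le_sum_of_subset_of_nonneg (Finset.filter_subset _ _)
              fun _ _ _ => noiseDensity_nonneg _
        _ ≤ ∑ _w : ι, Real.exp (-(n / 2 * Real.log (2 * Real.pi * τ))) :=
            Finset.sum_le_sum fun w _ => noiseDensity_le_exp hτ _
        _ = _ := by simp
    have := Real.log_le_log (mix_pos x S hτ w y) this
    rw [Real.log_mul (by positivity) (by positivity), Real.log_exp] at this
    linarith
  have hlow : -(n / 2 * Real.log (2 * Real.pi * τ)) - (normSq (x w) / τ + 1 / τ * normSq y) ≤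
      Real.log (mix τ x S (S w) y) := by
    have := Real.log_le_log (noiseDensity_pos hτ _) (noiseDensity_le_mix (τ := τ) x S w y)
    rw [log_noiseDensity hτ] at this
    have h3 : normSq (y - x w) / (2 * τ) ≤ normSq (x w) / τ + 1 / τ * normSq y := by
      rw [div_le_iff₀ (by positivity)]
      have := normSq_sub_le y (x w)
      have h4 : (normSq (x w) / τ + 1 / τ * normSq y) * (2 * τ) =
        2 * normSq y + 2 * normSq (x w) := by field_simp; ring
      linarith
    linarith
  rw [abs_le]
  constructor
  · linarith [le_abs_self (n / 2 * Real.log (2 * Real.pi * τ))]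
  · linarith [neg_abs_le (n / 2 * Real.log (2 * Real.pi * τ))]

lemma integrable_log_mix (hτ : τ ≠ 0) (θ : ℝ≥0) (w : ι) (v : Fin n → ℝ) :
    Integrable (fun z => Real.log (mix τ x S (S w) (v + z))) (noise n θ) :=
  integrable_of_quadratic_bound θ v (f := fun y => Real.log (mix τ x S (S w) y)) (by fun_prop)
    (by positivity) (abs_log_mix_le x S hτ w)

lemma lintegral_mix (hτ : τ ≠ 0) (s : σ) :
    ∫⁻ y, ENNReal.ofReal (mix τ x S s y) = (Finset.univ.filter (S · = s)).card := by
  unfold mix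
  simp only [ENNReal.ofReal_sum_of_nonneg fun _ _ => noiseDensity_nonneg _]
  rw [lintegral_finsetSum _ fun _ _ => by fun_prop]
  simp [lintegral_noiseDensity hτ]

lemma lintegral_sum_noiseDensity (hτ : τ ≠ 0) :
    ∫⁻ y, ENNReal.ofReal (∑ w, noiseDensity τ (y - x w)) = Fintype.card ι := by
  simpa [mix] using lintegral_mix (σ := Unit) x (fun _ => ()) hτ ()

/-- Gibbs' inequality for the noisy observation of a uniformly chosen `x w`. -/
lemma gibbs_noise (hτ : τ ≠ 0) {r : ι → (Fin n → ℝ) → ℝ} (hpos : ∀ w y, 0 < r w y)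
    (hm : ∀ w, Measurable (r w))
    (hlogint : ∀ w, Integrable (fun z => Real.log (r w (x w + z))) (noise n τ))
    (hle : ∫⁻ y, ENNReal.ofReal (∑ w, noiseDensity τ (y - x w) * r w y) ≤ Fintype.card ι) :
    ∑ w, ∫ z, Real.log (r w (x w + z)) ∂noise n τ ≤ 0 := by
  refine sum_integral_log_nonpos (noise n τ) (r := fun w z => r w (x w + z))
    (fun w z => hpos _ _) (fun w => (hm w).comp (measurable_const_add _)) hlogint (le_trans ?_ hle)
  have : ∀ w, ∫⁻ z, ENNReal.ofReal (r w (x w + z)) ∂noise n τ =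
      ∫⁻ y, ENNReal.ofReal (noiseDensity τ (y - x w) * r w y) := fun w => by
    rw [lintegral_noise hτ (x w) (f := fun y => ENNReal.ofReal (r w y)) (hm w).ennreal_ofReal]
    simp only [ENNReal.ofReal_mul (noiseDensity_nonneg _)]
  simp only [this]
  rw [← lintegral_finsetSum _ fun w _ => by have := hm w; fun_prop]
  refine lintegral_mono fun y => ?_
  rw [ENNReal.ofReal_sum_of_nonneg fun w _ => mul_nonneg (noiseDensity_nonneg _) (hpos w y).le]

/-- A finer partition has the smaller mixture. -/
lemma logMix_le_logMix_unit (hτ : τ ≠ 0) :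
    logMix τ x S ≤ logMix τ x (fun _ => ()) := by
  refine Finset.sum_le_sum fun w _ => integral_mono (integrable_log_mix x S hτ τ w _)
    (integrable_log_mix x (fun _ => ()) hτ τ w _) fun z => ?_
  refine Real.log_le_log (mix_pos x S hτ w _) ?_
  simp only [mix]
  exact Finset.sum_le_sum_of_subset_of_nonneg (fun _ _ => by simp)
    fun _ _ _ => noiseDensity_nonneg _

/-- Fano's inequality. -/
lemma logMix_unit_le_of_decoder [DecidableEq ι] (hτ : τ ≠ 0) {dec : (Fin n → ℝ) → ι}
    (hdec : ∀ w, MeasurableSet {y | dec y = w}) :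
    logMix τ x (fun _ => ()) ≤ ∑ _w : ι, ∫ z, Real.log (noiseDensity τ z) ∂noise n τ +
      Fintype.card ι * Real.log 2 +
      (∑ w, (noise n τ).real {z | dec (x w + z) ≠ w}) * Real.log (Fintype.card ι) := by
  rcases isEmpty_or_nonempty ι with hι | hι
  · simp [logMix]
  have hM : (1 : ℝ) ≤ Fintype.card ι := by exact_mod_cast Fintype.card_pos
  set M : ℝ := ((Fintype.card ι : ℕ) : ℝ) with hMdef
  -- The decoder as a strictly positive law on messages: half the mass on the decoded message, half
  -- uniform. The halving costs log 2; the uniform half limits the loss on the error event to a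
  -- further log M.
  set q : ι → (Fin n → ℝ) → ℝ := fun w y => (({y | dec y = w}.indicator 1 y) + 1 / M) / 2 with hq
  have hqm : ∀ w, Measurable (q w) := fun w => by
    have : Measurable ({y | dec y = w}.indicator (1 : (Fin n → ℝ) → ℝ)) :=
      measurable_one.indicator (hdec w)
    simp only [hq]; fun_prop
  have hq0 : ∀ w y, 1 / (2 * M) ≤ q w y := fun w y => by
    have : 0 ≤ {y | dec y = w}.indicator (1 : (Fin n → ℝ) → ℝ) y :=
      Set.indicator_nonneg (fun _ _ => zero_le_one) _
    have h2 : 1 / (2 * M) = (1 / M) / 2 := by field_simp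
    rw [h2]; simp only [hq]; linarith
  have hqpos : ∀ w y, 0 < q w y := fun w y => lt_of_lt_of_le (by positivity) (hq0 w y)
  have hq1 : ∀ w y, q w y ≤ 1 := fun w y => by
    have : {y | dec y = w}.indicator (1 : (Fin n → ℝ) → ℝ) y ≤ 1 :=
      Set.indicator_le_self' (fun _ _ => zero_le_one) _
    have h2 : 1 / M ≤ 1 := by rw [div_le_one (by positivity)]; exact hM
    simp only [hq]; linarith
  have hlogq : ∀ w z, -Real.log 2 - {z | dec (x w + z) ≠ w}.indicator (fun _ => Real.log M) z ≤
      Real.log (q w (x w + z)) := fun w z => by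
    by_cases h : dec (x w + z) = w
    · have : (1 : ℝ) / 2 ≤ q w (x w + z) := by
        have : 0 ≤ 1 / M := by positivity
        simp only [hq, Set.indicator, Set.mem_ofPred_eq, h, if_true, Pi.one_apply]; linarith
      have := Real.log_le_log (by norm_num) this
      simpa [Set.indicator, h] using this
    · have := Real.log_le_log (by positivity) (hq0 w (x w + z))
      rw [one_div, Real.log_inv, Real.log_mul (by norm_num) (by positivity)] at this
      simp [Set.indicator, h]; linarith
  have hqint : ∀ w, Integrable (fun z => Real.log (q w (x w + z))) (noise n τ) := fun w => by
    refine Integrable.of_bound (C := Real.log 2 + Real.log M)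
      ((Real.measurable_log.comp ((hqm w).comp (measurable_const_add _))).aestronglyMeasurable)
      (ae_of_all _ fun z => ?_)
    rw [Real.norm_eq_abs, abs_of_nonpos (Real.log_nonpos (hqpos _ _).le (hq1 _ _))]
    have := Real.log_le_log (by positivity) (hq0 w (x w + z))
    rw [one_div, Real.log_inv, Real.log_mul (by norm_num) (by positivity)] at this
    linarith
  have hms : ∀ w, MeasurableSet {z | dec (x w + z) ≠ w} := fun w =>
    ((hdec w).preimage (measurable_const_add (x w))).compl
  have hqlow : ∀ w, -Real.log 2 - (noise n τ).real {z | dec (x w + z) ≠ w} * Real.log M ≤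
      ∫ z, Real.log (q w (x w + z)) ∂noise n τ := fun w => by
    have hi : Integrable ({z | dec (x w + z) ≠ w}.indicator (fun _ => Real.log M)) (noise n τ) :=
      (integrable_const _).indicator (hms w)
    calc _ = ∫ z, (-Real.log 2 - {z | dec (x w + z) ≠ w}.indicator (fun _ => Real.log M) z)
          ∂noise n τ := by
          rw [integral_sub (integrable_const _) hi, integral_indicator_const _ (hms w)]
          simp
      _ ≤ _ := integral_mono ((integrable_const _).sub hi) (hqint w) (hlogq w)
  have hlogr : ∀ w z, Real.log (q w (x w + z) * mix τ x (fun _ => ()) () (x w + z) /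
      noiseDensity τ (x w + z - x w)) = Real.log (q w (x w + z)) +
        Real.log (mix τ x (fun _ => ()) () (x w + z)) - Real.log (noiseDensity τ z) := fun w z => by
    have := mix_pos x (fun _ => ()) hτ w (x w + z)
    rw [Real.log_div (mul_pos (hqpos _ _) this).ne' (noiseDensity_pos hτ _).ne',
      Real.log_mul (hqpos _ _).ne' this.ne']
    simp
  have hndint : Integrable (fun z => Real.log (noiseDensity τ z)) (noise n τ) := by
    simpa using integrable_log_noiseDensity hτ τ (0 : Fin n → ℝ) 1
  have hmixint := fun w => integrable_log_mix x (fun _ => ()) hτ τ w (x w)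
  have hG := gibbs_noise x hτ
    (r := fun w y => q w y * mix τ x (fun _ => ()) () y / noiseDensity τ (y - x w))
    (fun w y => div_pos (mul_pos (hqpos w y) (mix_pos x (fun _ => ()) hτ w y))
      (noiseDensity_pos hτ _)) (fun w => by have := hqm w; fun_prop)
    (fun w => by
      simp only [hlogr]
      exact ((hqint w).add (hmixint w)).sub hndint)
    (by
      rw [← lintegral_sum_noiseDensity x hτ]
      -- The Gaussian density of `w` cancels, and the `q w y` sum to 1 over w, so the mixture itself
      -- remains.
      refine lintegral_mono fun y => ENNReal.ofReal_le_ofReal ?_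
      have h1 : ∀ w, noiseDensity τ (y - x w) * (q w y * mix τ x (fun _ => ()) () y /
          noiseDensity τ (y - x w)) = q w y * mix τ x (fun _ => ()) () y := fun w =>
        mul_div_cancel₀ _ (noiseDensity_pos hτ _).ne'
      have h2 : ∑ w, q w y = 1 := by
        simp only [hq, ← Finset.sum_div, Finset.sum_add_distrib]
        have : (M : ℝ) ≠ 0 := by positivity
        have h3 : ∑ w, {y | dec y = w}.indicator (1 : (Fin n → ℝ) → ℝ) y = 1 := by
          simp [Set.indicator]
        rw [h3]
        simp only [Finset.sum_const, Finset.card_univ, nsmul_eq_mul, ← hMdef]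
        field_simp; norm_num
      simp only [h1, ← Finset.sum_mul, h2, one_mul]
      simp [mix])
  simp only [hlogr] at hG
  have h4 : ∀ w, ∫ z, (Real.log (q w (x w + z)) +
      Real.log (mix τ x (fun _ => ()) () (x w + z)) - Real.log (noiseDensity τ z)) ∂noise n τ =
      ∫ z, Real.log (q w (x w + z)) ∂noise n τ +
      ∫ z, Real.log (mix τ x (fun _ => ()) () (x w + z)) ∂noise n τ -
      ∫ z, Real.log (noiseDensity τ z) ∂noise n τ := fun w => by
    rw [integral_sub (by exact (hqint w).add (hmixint w)) hndint,
      integral_add (hqint w) (hmixint w)]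
  simp only [h4, Finset.sum_sub_distrib, Finset.sum_add_distrib] at hG
  have h5 := Finset.sum_le_sum fun w (_ : w ∈ Finset.univ) => hqlow w
  simp only [Finset.sum_sub_distrib, ← Finset.sum_mul] at h5
  have h6 : ∑ _w : ι, -Real.log 2 = -(M * Real.log 2) := by simp [M]
  rw [h6] at h5
  unfold logMix
  linarith

end Fibers

end CRAN
end

/-! ### Gaussian maximum entropy and submodularity of entropy. -/

noncomputable section

open scoped NNReal ENNReal

namespace CRAN

variable {n : ℕ} {τ : ℝ≥0} {ι σ : Type*} [Fintype ι] [DecidableEq σ]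
  (x : ι → Fin n → ℝ) (S : ι → σ)

/-- Lower bound on `logMix` by the Gaussian with centers `m` and the second moment of `x - m ∘ S`
plus noise. -/
lemma le_logMix_of_center [Fintype σ] (hτ : τ ≠ 0) (m : σ → Fin n → ℝ) {θ : ℝ≥0} (hθ : θ ≠ 0)
    (hm : ∑ w, normSq (x w - m (S w)) + Fintype.card ι * (n * τ) ≤ Fintype.card ι * (n * θ)) :
    Fintype.card ι * (Real.log (Fintype.card ι) - Real.log (Fintype.card σ) -
      n / 2 * (Real.log (2 * Real.pi * θ) + 1)) ≤ logMix τ x S := by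
  rcases isEmpty_or_nonempty ι with hι | hι
  · simp [logMix]
  have hM : (0 : ℝ) < Fintype.card ι := by exact_mod_cast Fintype.card_pos
  have hσ' : 0 < Fintype.card σ := Fintype.card_pos_iff.2 ⟨S (Classical.arbitrary ι)⟩
  have hσ : (0 : ℝ) < Fintype.card σ := by exact_mod_cast hσ'
  have hθ' : (0 : ℝ) < θ := by positivity
  set M : ℝ := ((Fintype.card ι : ℕ) : ℝ) with hMdef
  set K : ℝ := ((Fintype.card σ : ℕ) : ℝ) with hKdef
  have hlogr : ∀ w z, Real.log (M / K * noiseDensity θ (x w + z - m (S w)) /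
      mix τ x S (S w) (x w + z)) = (Real.log M - Real.log K) +
        Real.log (noiseDensity θ ((x w - m (S w)) + (1 : ℝ) • z)) -
          Real.log (mix τ x S (S w) (x w + z)) := fun w z => by
    have h0 : x w + z - m (S w) = (x w - m (S w)) + (1 : ℝ) • z := by rw [one_smul]; abel
    have := noiseDensity_pos hθ (x w + z - m (S w))
    rw [Real.log_div (by positivity) (mix_pos x S hτ w _).ne', Real.log_mul (by positivity) this.ne',
      Real.log_div hM.ne' hσ.ne', h0]
  have hi1 := fun w => integrable_log_noiseDensity hθ τ (x w - m (S w)) 1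
  have hi2 := fun w => integrable_log_mix x S hτ τ w (x w)
  -- The reference law is uniform on `σ` with a Gaussian of variance θ around `m s`. The factor M /
  -- K makes its total mass M, as Gibbs' inequality requires.
  have hG := gibbs_noise x hτ
    (r := fun w y => M / K * noiseDensity θ (y - m (S w)) / mix τ x S (S w) y)
    (fun w y => div_pos (mul_pos (by positivity) (noiseDensity_pos hθ _)) (mix_pos x S hτ w y))
    (fun w => by fun_prop)
    (fun w => by
      simp only [hlogr]
      exact ((integrable_const _).add (hi1 w)).sub (hi2 w))
    (by
      have h1 : ∀ y, ENNReal.ofReal (∑ w, noiseDensity τ (y - x w) *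
          (M / K * noiseDensity θ (y - m (S w)) / mix τ x S (S w) y)) ≤
          ENNReal.ofReal (M / K) * ∑ s, ENNReal.ofReal (noiseDensity θ (y - m s)) := fun y => by
        rw [← ENNReal.ofReal_sum_of_nonneg fun _ _ => noiseDensity_nonneg _,
          ← ENNReal.ofReal_mul (by positivity), Finset.mul_sum]
        exact ENNReal.ofReal_le_ofReal (sum_mul_div_fiber_le S (fun w => noiseDensity_nonneg _)
          (q := fun s => M / K * noiseDensity θ (y - m s))
          fun s => mul_nonneg (by positivity) (noiseDensity_nonneg _))
      refine (lintegral_mono h1).trans ?_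
      rw [lintegral_const_mul _ (by fun_prop), lintegral_finsetSum _ fun _ _ => by fun_prop]
      simp only [lintegral_noiseDensity hθ, Finset.sum_const, Finset.card_univ, nsmul_eq_mul,
        mul_one]
      rw [← ENNReal.ofReal_natCast (Fintype.card σ), ← ENNReal.ofReal_mul (by positivity),
        div_mul_cancel₀ _ hσ.ne', hMdef, ENNReal.ofReal_natCast])
  simp only [hlogr] at hG
  have h4 : ∀ w, ∫ z, ((Real.log M - Real.log K) +
        Real.log (noiseDensity θ ((x w - m (S w)) + (1 : ℝ) • z)) -
          Real.log (mix τ x S (S w) (x w + z))) ∂noise n τ = (Real.log M - Real.log K) +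
      (-(n / 2 * Real.log (2 * Real.pi * θ)) - (normSq (x w - m (S w)) + (n * τ)) / (2 * θ)) -
      ∫ z, Real.log (mix τ x S (S w) (x w + z)) ∂noise n τ := fun w => by
    rw [integral_sub (by exact (integrable_const _).add (hi1 w)) (hi2 w),
      integral_add (integrable_const _) (hi1 w), integral_log_noiseDensity hθ]
    simp
  simp only [h4, Finset.sum_sub_distrib, Finset.sum_add_distrib, ← Finset.sum_div,
    Finset.sum_const, Finset.card_univ, nsmul_eq_mul, ← hMdef] at hG
  -- The second-moment hypothesis bounds the quadratic term by n / 2 per message, its value for a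
  -- Gaussian of variance θ.
  have h5 : (∑ w, normSq (x w - m (S w)) + M * (n * τ)) / (2 * θ) ≤ M * (n / 2) := by
    rw [div_le_iff₀ (by positivity)]
    linarith
  unfold logMix
  linarith

/-- Nonnegativity of the conditional mutual information of `S₁` and `S₂` given `T` and the noisy
observation. -/
lemma logMix_add_logMix_le {σ₁ σ₂ ρ : Type*} [DecidableEq σ₁] [DecidableEq σ₂] [DecidableEq ρ]
    (hτ : τ ≠ 0)
    (S₁ : ι → σ₁) (S₂ : ι → σ₂) (T : ι → ρ) (h₁ : ∀ w w', S₁ w = S₁ w' → T w = T w')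
    (h₂ : ∀ w w', S₂ w = S₂ w' → T w = T w') :
    logMix τ x S₁ + logMix τ x S₂ ≤ logMix τ x T + logMix τ x (fun w => (S₁ w, S₂ w)) := by
  set D : ι → σ₁ × σ₂ := fun w => (S₁ w, S₂ w) with hD
  have hlogr : ∀ w z, Real.log (mix τ x S₁ (S₁ w) (x w + z) * mix τ x S₂ (S₂ w) (x w + z) /
      (mix τ x T (T w) (x w + z) * mix τ x D (D w) (x w + z))) =
      (Real.log (mix τ x S₁ (S₁ w) (x w + z)) + Real.log (mix τ x S₂ (S₂ w) (x w + z))) -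
      (Real.log (mix τ x T (T w) (x w + z)) + Real.log (mix τ x D (D w) (x w + z))) :=
    fun w z => by
      have h1 := mix_pos x S₁ hτ w (x w + z)
      have h2 := mix_pos x S₂ hτ w (x w + z)
      have h3 := mix_pos x T hτ w (x w + z)
      have h4 := mix_pos x D hτ w (x w + z)
      rw [Real.log_div (by positivity) (by positivity), Real.log_mul h1.ne' h2.ne',
        Real.log_mul h3.ne' h4.ne']
  have hi1 := fun w => integrable_log_mix x S₁ hτ τ w (x w)
  have hi2 := fun w => integrable_log_mix x S₂ hτ τ w (x w)
  have hi3 := fun w => integrable_log_mix x T hτ τ w (x w)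
  have hi4 := fun w => integrable_log_mix x D hτ τ w (x w)
  -- The ratio compares the product of the conditional laws of S₁ and S₂ given T and y with their
  -- joint conditional law.
  have hG := gibbs_noise x hτ
    (r := fun w y => mix τ x S₁ (S₁ w) y * mix τ x S₂ (S₂ w) y /
      (mix τ x T (T w) y * mix τ x D (D w) y))
    (fun w y => div_pos (mul_pos (mix_pos x S₁ hτ w y) (mix_pos x S₂ hτ w y))
      (mul_pos (mix_pos x T hτ w y) (mix_pos x D hτ w y)))
    (fun w => by fun_prop)
    (fun w => by
      simp only [hlogr]
      exact ((hi1 w).add (hi2 w)).sub ((hi3 w).add (hi4 w)))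
    (by
      rw [← lintegral_sum_noiseDensity x hτ]
      exact lintegral_mono fun y => ENNReal.ofReal_le_ofReal
        (sum_mul_fiber_ratio_le S₁ S₂ T h₁ h₂ fun w => noiseDensity_pos hτ (y - x w)))
  simp only [hlogr] at hG
  have h4 : ∀ w, ∫ z, ((Real.log (mix τ x S₁ (S₁ w) (x w + z)) +
        Real.log (mix τ x S₂ (S₂ w) (x w + z))) -
      (Real.log (mix τ x T (T w) (x w + z)) + Real.log (mix τ x D (D w) (x w + z)))) ∂noise n τ =
      (∫ z, Real.log (mix τ x S₁ (S₁ w) (x w + z)) ∂noise n τ +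
        ∫ z, Real.log (mix τ x S₂ (S₂ w) (x w + z)) ∂noise n τ) -
      (∫ z, Real.log (mix τ x T (T w) (x w + z)) ∂noise n τ +
        ∫ z, Real.log (mix τ x D (D w) (x w + z)) ∂noise n τ) := fun w => by
    rw [integral_sub (by exact (hi1 w).add (hi2 w)) (by exact (hi3 w).add (hi4 w)),
      integral_add (hi1 w) (hi2 w), integral_add (hi3 w) (hi4 w)]
  simp only [h4, Finset.sum_sub_distrib, Finset.sum_add_distrib] at hG
  unfold logMix
  linarith

/-- If `x` is constant on the fibers of `S`, then `logMix` depends on the noise only through the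
entropy of the noise. -/
lemma logMix_of_factors (hτ : τ ≠ 0) (hS : ∀ w w', S w = S w' → x w = x w') :
    logMix τ x S = ∑ w, Real.log (Finset.univ.filter (S · = S w)).card -
      Fintype.card ι * (n / 2 * (Real.log (2 * Real.pi * τ) + 1)) := by
  have hτ' : (0 : ℝ) < τ := by positivity
  have hmix : ∀ w y, mix τ x S (S w) y =
      (Finset.univ.filter (S · = S w)).card * noiseDensity τ (y - x w) := fun w y => by
    unfold mix
    rw [Finset.sum_congr rfl fun w' hw' => by rw [hS w' w (Finset.mem_filter.1 hw').2]]
    simp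
  have h1 : ∀ w, ∫ z, Real.log (mix τ x S (S w) (x w + z)) ∂noise n τ =
      Real.log (Finset.univ.filter (S · = S w)).card -
        n / 2 * (Real.log (2 * Real.pi * τ) + 1) := fun w => by
    have hc : ((Finset.univ.filter (S · = S w)).card : ℝ) ≠ 0 := by
      exact_mod_cast (Finset.card_pos.2 ⟨w, by simp⟩).ne'
    have : ∀ z, Real.log (mix τ x S (S w) (x w + z)) =
        Real.log (Finset.univ.filter (S · = S w)).card +
          Real.log (noiseDensity τ (0 + (1 : ℝ) • z)) := fun z => by
      rw [hmix, Real.log_mul hc (noiseDensity_pos hτ _).ne']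
      simp
    simp only [this]
    rw [integral_add (integrable_const _) (integrable_log_noiseDensity hτ τ 0 1),
      integral_log_noiseDensity hτ]
    simp [normSq]
    field_simp
    ring
  simp only [logMix, h1, Finset.sum_sub_distrib]
  simp

end CRAN
end

/-! ### Gaussian noise is the worst additive noise for a Gaussian input. -/

noncomputable section

open scoped NNReal ENNReal

namespace CRAN

variable {n : ℕ} {τ : ℝ≥0} {ι σ : Type*} [Fintype ι] [DecidableEq σ]
  (x : ι → Fin n → ℝ) (S : ι → σ)

lemma integrable_normSq_affine_prod (τ₁ τ₂ : ℝ≥0) (a b : ℝ) (c : Fin n → ℝ) :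
    Integrable (fun p : (Fin n → ℝ) × (Fin n → ℝ) => normSq (c + a • p.1 + b • p.2))
      ((noise n τ₁).prod (noise n τ₂)) := by
  have h1 : Integrable (fun p : (Fin n → ℝ) × (Fin n → ℝ) =>
      2 * normSq (c + a • p.1) + 2 * normSq (0 + b • p.2)) ((noise n τ₁).prod (noise n τ₂)) :=
    (((integrable_normSq_affine τ₁ a c).const_mul 2).comp_fst _).add
      (((integrable_normSq_affine τ₂ b 0).const_mul 2).comp_snd _)
  refine h1.mono' (by exact Measurable.aestronglyMeasurable (by fun_prop)) (ae_of_all _ fun p => ?_)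
  rw [Real.norm_eq_abs, abs_of_nonneg (normSq_nonneg _), zero_add]
  exact normSq_add_le _ _

lemma integral_normSq_affine_prod (τ₁ τ₂ : ℝ≥0) (a b : ℝ) (c : Fin n → ℝ) :
    ∫ p : (Fin n → ℝ) × (Fin n → ℝ), normSq (c + a • p.1 + b • p.2)
      ∂((noise n τ₁).prod (noise n τ₂)) =
      normSq c + a ^ 2 * (n * τ₁) + b ^ 2 * (n * τ₂) := by
  rw [integral_prod _ (integrable_normSq_affine_prod τ₁ τ₂ a b c)]
  simp only [integral_normSq_affine]
  rw [integral_add (integrable_normSq_affine τ₁ a c) (integrable_const _), integral_normSq_affine]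
  simp

/-- Density of the noisy observation `u`, times the backward channel from `u` to the second noise. -/
def backward (τ N β : ℝ≥0) (α : ℝ) (x : ι → Fin n → ℝ) (S : ι → σ) (m : σ → Fin n → ℝ) (s : σ)
    (u g : Fin n → ℝ) : ℝ :=
  mix (τ + N) x S s u * noiseDensity β (g - α • (u - m s))

/-- For fixed g the shift y ↦ y + g preserves Lebesgue measure, so u = y + g may replace y.
Integrating g first then gives 1, since the backward channel is a probability density in g, and the
mass of the mixture is left. -/
lemma lintegral_lintegral_backward {N β : ℝ≥0} (hτ : τ ≠ 0) (hβ : β ≠ 0) (α : ℝ)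
    (m : σ → Fin n → ℝ) (s : σ) :
    ∫⁻ y, ∫⁻ g, ENNReal.ofReal (backward τ N β α x S m s (y + g) g) =
      (Finset.univ.filter (S · = s)).card := by
  have hτN : τ + N ≠ 0 := by positivity
  have hmeas : Measurable (fun p : (Fin n → ℝ) × (Fin n → ℝ) =>
      ENNReal.ofReal (backward τ N β α x S m s p.1 p.2)) := by
    unfold backward; fun_prop
  rw [lintegral_lintegral_swap (by
    exact (hmeas.comp (g := fun p : (Fin n → ℝ) × (Fin n → ℝ) =>
      ENNReal.ofReal (backward τ N β α x S m s p.1 p.2))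
      (f := fun p : (Fin n → ℝ) × (Fin n → ℝ) => (p.1 + p.2, p.2)) (by fun_prop)).aemeasurable)]
  have h1 : ∀ g, ∫⁻ y, ENNReal.ofReal (backward τ N β α x S m s (y + g) g) =
      ∫⁻ u, ENNReal.ofReal (backward τ N β α x S m s u g) := fun g =>
    lintegral_add_right_eq_self (fun u => ENNReal.ofReal (backward τ N β α x S m s u g)) g
  simp only [h1]
  rw [lintegral_lintegral_swap (by exact (hmeas.comp measurable_swap).aemeasurable)]
  unfold backward
  simp only [ENNReal.ofReal_mul (mix_nonneg x S s _)]
  have h2 : ∀ u, ∫⁻ g, ENNReal.ofReal (mix (τ + N) x S s u) *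
      ENNReal.ofReal (noiseDensity β (g - α • (u - m s))) =
      ENNReal.ofReal (mix (τ + N) x S s u) := fun u => by
    rw [lintegral_const_mul _ (by fun_prop), lintegral_noiseDensity hβ, mul_one]
  simp only [h2, lintegral_mix x S hτN s]

/-- Extra Gaussian noise of variance `N` raises the entropy at least as much as it does for Gaussian
observations of the same second moment `φ` around the centers. -/
lemma logMix_add_le [Fintype σ] (hτ : τ ≠ 0) (m : σ → Fin n → ℝ) {N φ : ℝ≥0} (hN : N ≠ 0)
    (hφ : φ ≠ 0)
    (hm : ∑ w, normSq (x w - m (S w)) + Fintype.card ι * (n * τ) ≤ Fintype.card ι * (n * φ)) :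
    logMix (τ + N) x S ≤
      logMix τ x S + Fintype.card ι * (n / 2 * Real.log (φ / (φ + N))) := by
  have hτN : τ + N ≠ 0 := by positivity
  have hN' : (0 : ℝ) < N := by positivity
  have hφ' : (0 : ℝ) < φ := by positivity
  -- α and β are the coefficient and the error variance of the linear estimate of G from Y + G when
  -- G has variance N and Y has variance φ around its center.
  set α : ℝ := N / (φ + N) with hα
  set β : ℝ≥0 := N * φ / (φ + N) with hβdef
  have hβ : β ≠ 0 := by positivity
  have hβ' : (0 : ℝ) < β := by positivity
  have hβr : (β : ℝ) = N * φ / (φ + N) := by simp [hβdef]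
  set μ := (noise n τ).prod (noise n N)
  set c : ι → Fin n → ℝ := fun w => (-α) • (x w - m (S w))
  have harg : ∀ w (p : (Fin n → ℝ) × (Fin n → ℝ)), p.2 - α • (x w + p.1 + p.2 - m (S w)) =
      c w + (-α) • p.1 + (1 - α) • p.2 := fun w p => by
    ext i; simp [c]; ring
  -- Backward over forward description of the pair (Y, G): the mixture of Y + G times a Gaussian
  -- guess of G from it, over the density of G times the mixture of Y. Gibbs' inequality says that
  -- this guess cannot beat the true posterior, which bounds I(G; Y + G | S) from below.
  set r : ι → (Fin n → ℝ) × (Fin n → ℝ) → ℝ := fun w p =>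
    backward τ N β α x S m (S w) (x w + p.1 + p.2) p.2 /
      (noiseDensity N p.2 * mix τ x S (S w) (x w + p.1)) with hr
  have hbpos : ∀ w u g, 0 < backward τ N β α x S m (S w) u g := fun w u g =>
    mul_pos (mix_pos x S hτN w _) (noiseDensity_pos hβ _)
  have hrpos : ∀ w p, 0 < r w p := fun w p =>
    div_pos (hbpos _ _ _) (mul_pos (noiseDensity_pos hN _) (mix_pos x S hτ w _))
  have hrm : ∀ w, Measurable (r w) := fun w => by
    simp only [hr, backward]; fun_prop
  have hlogr : ∀ w p, Real.log (r w p) = (Real.log (mix (τ + N) x S (S w) (x w + (p.1 + p.2))) +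
      (-(n / 2 * Real.log (2 * Real.pi * β)) -
        normSq (c w + (-α) • p.1 + (1 - α) • p.2) / (2 * β))) -
      (Real.log (noiseDensity N p.2) + Real.log (mix τ x S (S w) (x w + p.1))) := fun w p => by
    have h1 := mix_pos x S hτ w (x w + p.1)
    have h2 := mix_pos x S hτN w (x w + p.1 + p.2)
    have h3 := noiseDensity_pos hN p.2
    have h4 := noiseDensity_pos hβ (p.2 - α • (x w + p.1 + p.2 - m (S w)))
    simp only [hr, backward]
    rw [Real.log_div (mul_pos h2 h4).ne' (mul_pos h3 h1).ne', Real.log_mul h2.ne' h4.ne',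
      Real.log_mul h3.ne' h1.ne', log_noiseDensity hβ, harg, add_assoc]
  have hmap : ∀ w, Integrable (fun p : (Fin n → ℝ) × (Fin n → ℝ) =>
      Real.log (mix (τ + N) x S (S w) (x w + (p.1 + p.2)))) μ ∧
      ∫ p, Real.log (mix (τ + N) x S (S w) (x w + (p.1 + p.2))) ∂μ =
        ∫ z, Real.log (mix (τ + N) x S (S w) (x w + z)) ∂noise n (τ + N) := fun w => by
    have hi := integrable_log_mix x S hτN (τ + N) w (x w)
    rw [← map_add_noise_prod] at hi ⊢
    refine ⟨(integrable_map_measure hi.aestronglyMeasurable (by fun_prop)).1 hi, ?_⟩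
    rw [integral_map (by fun_prop) hi.aestronglyMeasurable]
  have hi1 := fun w => (hmap w).1
  have hi2 : ∀ w, Integrable (fun p : (Fin n → ℝ) × (Fin n → ℝ) =>
      (-(n / 2 * Real.log (2 * Real.pi * β)) -
        normSq (c w + (-α) • p.1 + (1 - α) • p.2) / (2 * β))) μ := fun w =>
    (integrable_const _).sub ((integrable_normSq_affine_prod τ N (-α) (1 - α) (c w)).div_const _)
  have hi3' : Integrable (fun z => Real.log (noiseDensity N z)) (noise n N) := by
    simpa using integrable_log_noiseDensity hN N (0 : Fin n → ℝ) 1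
  have hi3 : Integrable (fun p : (Fin n → ℝ) × (Fin n → ℝ) => Real.log (noiseDensity N p.2)) μ :=
    hi3'.comp_snd _
  have hi4 : ∀ w, Integrable (fun p : (Fin n → ℝ) × (Fin n → ℝ) =>
      Real.log (mix τ x S (S w) (x w + p.1))) μ := fun w =>
    (integrable_log_mix x S hτ τ w (x w)).comp_fst _
  have hle : ∑ w, ∫⁻ p, ENNReal.ofReal (r w p) ∂μ ≤ Fintype.card ι := by
    have h1 : ∀ w, ∫⁻ p, ENNReal.ofReal (r w p) ∂μ =
        ∫⁻ y, ∫⁻ g, ENNReal.ofReal (noiseDensity τ (y - x w) *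
          (backward τ N β α x S m (S w) (y + g) g / mix τ x S (S w) y)) := fun w => by
      rw [lintegral_prod _ (hrm w).ennreal_ofReal.aemeasurable]
      have h2 : ∀ z, ∫⁻ g, ENNReal.ofReal (r w (z, g)) ∂noise n N =
          (fun y => ∫⁻ g, ENNReal.ofReal
            (backward τ N β α x S m (S w) (y + g) g / mix τ x S (S w) y)) (x w + z) := fun z => by
        have := lintegral_noise hN 0 (f := fun g => ENNReal.ofReal (r w (z, g)))
          ((hrm w).comp measurable_prodMk_left).ennreal_ofReal
        simp only [zero_add, sub_zero] at this
        rw [this]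
        refine lintegral_congr fun g => ?_
        rw [← ENNReal.ofReal_mul (noiseDensity_nonneg _)]
        congr 1
        have h3 := noiseDensity_pos hN g
        have h4 := mix_pos x S hτ w (x w + z)
        simp only [hr]
        field_simp
      simp only [h2]
      rw [lintegral_noise hτ (x w) (f := fun y => ∫⁻ g, ENNReal.ofReal
        (backward τ N β α x S m (S w) (y + g) g / mix τ x S (S w) y))
        (Measurable.lintegral_prod_right (by unfold backward; fun_prop))]
      refine lintegral_congr fun y => ?_
      rw [← lintegral_const_mul _ (by unfold backward; fun_prop)]
      simp only [ENNReal.ofReal_mul (noiseDensity_nonneg (τ := τ) (y - x w))]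
    simp only [h1]
    rw [← lintegral_finsetSum _ fun w _ => Measurable.lintegral_prod_right (by
        unfold backward; fun_prop)]
    have h5 : ∀ y, ∑ w, ∫⁻ g, ENNReal.ofReal (noiseDensity τ (y - x w) *
          (backward τ N β α x S m (S w) (y + g) g / mix τ x S (S w) y)) ≤
        ∑ s, ∫⁻ g, ENNReal.ofReal (backward τ N β α x S m s (y + g) g) := fun y => by
      rw [← lintegral_finsetSum _ fun w _ => by unfold backward; fun_prop,
        ← lintegral_finsetSum _ fun w _ => by unfold backward; fun_prop]
      refine lintegral_mono fun g => ?_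
      have hb : ∀ s, 0 ≤ backward τ N β α x S m s (y + g) g := fun s =>
        mul_nonneg (mix_nonneg _ _ _ _) (noiseDensity_nonneg _)
      rw [← ENNReal.ofReal_sum_of_nonneg fun w _ => mul_nonneg (noiseDensity_nonneg _)
        (div_nonneg (hb _) (mix_nonneg _ _ _ _)), ← ENNReal.ofReal_sum_of_nonneg fun s _ => hb s]
      exact ENNReal.ofReal_le_ofReal (sum_mul_div_fiber_le S (fun w => noiseDensity_nonneg _)
        (q := fun s => backward τ N β α x S m s (y + g) g) hb)
    refine (lintegral_mono h5).trans ?_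
    rw [lintegral_finsetSum _ fun w _ => Measurable.lintegral_prod_right (by
        unfold backward; fun_prop)]
    simp only [lintegral_lintegral_backward x S hτ hβ]
    rw [← Nat.cast_sum, ← Finset.card_eq_sum_card_fiberwise (fun _ _ => by simp), Finset.card_univ]
  have hG := sum_integral_log_nonpos μ hrpos hrm (fun w => by
      simp only [hlogr]
      exact ((hi1 w).add (hi2 w)).sub (hi3.add (hi4 w))) hle
  simp only [hlogr] at hG
  have hI3 : ∫ p : (Fin n → ℝ) × (Fin n → ℝ), Real.log (noiseDensity N p.2) ∂μ =
      -(n / 2 * (Real.log (2 * Real.pi * N) + 1)) := by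
    have := integral_log_noiseDensity hN N (0 : Fin n → ℝ) 1
    simp only [zero_add, one_smul] at this
    rw [integral_fun_snd (fun z => Real.log (noiseDensity N z)), this]
    simp [normSq]
    field_simp
    ring
  have hI4 : ∀ w, ∫ p : (Fin n → ℝ) × (Fin n → ℝ), Real.log (mix τ x S (S w) (x w + p.1)) ∂μ =
      ∫ z, Real.log (mix τ x S (S w) (x w + z)) ∂noise n τ := fun w => by
    rw [integral_fun_fst (fun z => Real.log (mix τ x S (S w) (x w + z)))]
    simp
  have hI2 : ∀ w, ∫ p : (Fin n → ℝ) × (Fin n → ℝ), (-(n / 2 * Real.log (2 * Real.pi * β)) -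
        normSq (c w + (-α) • p.1 + (1 - α) • p.2) / (2 * β)) ∂μ =
      -(n / 2 * Real.log (2 * Real.pi * β)) - (α ^ 2 * normSq (x w - m (S w)) +
        α ^ 2 * (n * τ) + (1 - α) ^ 2 * (n * N)) / (2 * β) := fun w => by
    rw [integral_sub (integrable_const _)
      ((integrable_normSq_affine_prod τ N (-α) (1 - α) (c w)).div_const _), integral_div,
      integral_normSq_affine_prod]
    have : normSq (c w) = α ^ 2 * normSq (x w - m (S w)) := by
      simp only [normSq, c, Pi.smul_apply, smul_eq_mul, mul_pow, ← Finset.mul_sum]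
      ring
    rw [this]
    simp
  have h4 : ∀ w, ∫ p, ((Real.log (mix (τ + N) x S (S w) (x w + (p.1 + p.2))) +
      (-(n / 2 * Real.log (2 * Real.pi * β)) -
        normSq (c w + (-α) • p.1 + (1 - α) • p.2) / (2 * β))) -
      (Real.log (noiseDensity N p.2) + Real.log (mix τ x S (S w) (x w + p.1)))) ∂μ =
      (∫ z, Real.log (mix (τ + N) x S (S w) (x w + z)) ∂noise n (τ + N) +
      (-(n / 2 * Real.log (2 * Real.pi * β)) - (α ^ 2 * normSq (x w - m (S w)) +
        α ^ 2 * (n * τ) + (1 - α) ^ 2 * (n * N)) / (2 * β))) -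
      (-(n / 2 * (Real.log (2 * Real.pi * N) + 1)) +
        ∫ z, Real.log (mix τ x S (S w) (x w + z)) ∂noise n τ) := fun w => by
    rw [integral_sub (by exact (hi1 w).add (hi2 w)) (by exact hi3.add (hi4 w)),
      integral_add (hi1 w) (hi2 w), integral_add hi3 (hi4 w), (hmap w).2, hI2, hI3, hI4]
  simp only [h4, Finset.sum_sub_distrib, Finset.sum_add_distrib, ← Finset.sum_div,
    Finset.sum_const, Finset.card_univ, nsmul_eq_mul, ← Finset.mul_sum] at hG
  set M : ℝ := ((Fintype.card ι : ℕ) : ℝ) with hMdef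
  have h5 : (α ^ 2 * ∑ w, normSq (x w - m (S w)) + M * (α ^ 2 * (n * τ)) +
      M * ((1 - α) ^ 2 * (n * N))) / (2 * β) ≤ M * (n / 2) := by
    rw [div_le_iff₀ (by positivity)]
    -- The identity α²φ + (1 - α)²N = β: at second moment φ the estimation error has variance
    -- exactly β.
    have h6 : α ^ 2 * (M * (n * φ)) + M * ((1 - α) ^ 2 * (n * N)) = M * (n / 2) * (2 * β) := by
      rw [hβr, hα]; field_simp; ring
    have := mul_le_mul_of_nonneg_left hm (sq_nonneg α)
    linarith
  have h7 : Real.log (2 * Real.pi * β) - Real.log (2 * Real.pi * N) = Real.log (φ / (φ + N)) := by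
    rw [← Real.log_div (by positivity) (by positivity), hβr]
    congr 1
    field_simp
  unfold logMix
  rw [← h7]
  linarith

end CRAN
end

/-! ### Rate bounds from a revealed side information. -/

noncomputable section

open scoped NNReal ENNReal

namespace CRAN

variable {n : ℕ} {ι : Type*} [Fintype ι] {x : ι → Fin n → ℝ} {δ : ℝ}

/-- Converse bound for a genie that reveals `S`, with `m` an estimate of `x` from `S`. -/
lemma log_card_le_of_center [Nonempty ι] {σ : Type*} [Fintype σ] [DecidableEq σ] (S : ι → σ)
    (hδ : logMix 1 x S ≤ Fintype.card ι * (δ - n / 2 * (Real.log (2 * Real.pi) + 1)))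
    (m : σ → Fin n → ℝ) {v : ℝ} (hv0 : 0 ≤ v)
    (hv : ∑ w, normSq (x w - m (S w)) ≤ Fintype.card ι * (n * v)) :
    Real.log (Fintype.card ι) ≤
      Real.log (Fintype.card σ) + n / 2 * Real.log (1 + v) + δ := by
  have hM : (0 : ℝ) < Fintype.card ι := by exact_mod_cast Fintype.card_pos
  lift v to ℝ≥0 using hv0
  have h := le_logMix_of_center x S one_ne_zero m (θ := 1 + v) (by positivity)
    (by push_cast; linarith)
  have h2 := le_of_mul_le_mul_left (h.trans hδ) hM
  push_cast at h2
  rw [Real.log_mul (by positivity) (by positivity)] at h2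
  linarith

/-- Converse bound on twice the rate, from the dependence of `S₁` and `S₂` given `T`. -/
lemma two_mul_log_card_le [Nonempty ι] {σ₁ σ₂ ρ : Type*} [Fintype σ₁] [DecidableEq σ₁] [Fintype σ₂]
    [DecidableEq σ₂] [Fintype ρ] [DecidableEq ρ] (S₁ : ι → σ₁) (S₂ : ι → σ₂) (T : ι → ρ)
    (h₁ : ∀ w w', S₁ w = S₁ w' → T w = T w') (h₂ : ∀ w w', S₂ w = S₂ w' → T w = T w')
    (hx : ∀ w w', S₁ w = S₁ w' → S₂ w = S₂ w' → x w = x w')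
    (hδT : logMix 1 x T ≤ Fintype.card ι * (δ - n / 2 * (Real.log (2 * Real.pi) + 1)))
    (hδS : logMix 1 x (fun w => (S₁ w, S₂ w)) ≤
      Fintype.card ι * (δ - n / 2 * (Real.log (2 * Real.pi) + 1)))
    (m₁ : σ₁ → Fin n → ℝ) (m₂ : σ₂ → Fin n → ℝ) (m : ρ → Fin n → ℝ) {v₁ v₂ v N : ℝ}
    (hv₁0 : 0 ≤ v₁) (hv₂0 : 0 ≤ v₂) (hv0 : 0 ≤ v) (hN0 : 0 ≤ N)
    (hv₁ : ∑ w, normSq (x w - m₁ (S₁ w)) ≤ Fintype.card ι * (n * v₁))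
    (hv₂ : ∑ w, normSq (x w - m₂ (S₂ w)) ≤ Fintype.card ι * (n * v₂))
    (hv : ∑ w, normSq (x w - m (T w)) ≤ Fintype.card ι * (n * v)) :
    2 * Real.log (Fintype.card ι) ≤ Real.log (Fintype.card σ₁) + Real.log (Fintype.card σ₂) +
      n / 2 * Real.log ((1 + v) * (1 + N + v₁) * (1 + N + v₂) / ((1 + N) * (N + (1 + v)))) +
      2 * δ := by
  have hM : (0 : ℝ) < Fintype.card ι := by exact_mod_cast Fintype.card_pos
  lift v to ℝ≥0 using hv0
  lift v₁ to ℝ≥0 using hv₁0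
  lift v₂ to ℝ≥0 using hv₂0
  lift N to ℝ≥0 using hN0
  have hN1 : 1 + N ≠ 0 := by positivity
  have e1 := le_logMix_of_center x S₁ hN1 m₁ (θ := 1 + N + v₁) (by positivity)
    (by push_cast; linarith)
  have e2 := le_logMix_of_center x S₂ hN1 m₂ (θ := 1 + N + v₂) (by positivity)
    (by push_cast; linarith)
  have e3 := logMix_add_logMix_le x hN1 S₁ S₂ T h₁ h₂
  have hfac : ∀ w w', (S₁ w, S₂ w) = (S₁ w', S₂ w') → x w = x w' := fun w w' h =>
    hx w w' (Prod.ext_iff.1 h).1 (Prod.ext_iff.1 h).2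
  -- The two views together determine x, so passing from noise 1 to noise 1 + N changes this term
  -- only by the noise entropy; this is the source of the factor 1 + N in the denominator.
  have e4 := logMix_of_factors x (fun w => (S₁ w, S₂ w)) hN1 hfac
  have e5 := logMix_of_factors x (fun w => (S₁ w, S₂ w)) one_ne_zero hfac
  have e6 : logMix (1 + N) x T ≤ logMix 1 x T +
      Fintype.card ι * (n / 2 * Real.log ((1 + v) / (1 + v + N))) := by
    -- N = 0 is separate because the backward channel would have variance 0; the claimed change is
    -- then log 1.
    rcases eq_or_ne N 0 with rfl | hN
    · have : (1 + v : ℝ) ≠ 0 := by positivity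
      simp [div_self this]
    · have := logMix_add_le x T one_ne_zero m hN (φ := 1 + v) (by positivity)
        (by push_cast; linarith)
      exact_mod_cast this
  have hlog : Real.log ((1 + v : ℝ) * (1 + N + v₁) * (1 + N + v₂) / ((1 + N) * (N + (1 + v)))) =
      Real.log ((1 + v) / (1 + v + N)) + Real.log (1 + N + v₁) + Real.log (1 + N + v₂) -
        Real.log (1 + N) := by
    have e : (1 + v : ℝ) * (1 + N + v₁) * (1 + N + v₂) / ((1 + N) * (N + (1 + v))) =
        (1 + v) / (1 + v + N) * (1 + N + v₁) * (1 + N + v₂) / (1 + N) := by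
      field_simp; ring
    rw [e, Real.log_div (by positivity) (by positivity), Real.log_mul (by positivity) (by positivity),
      Real.log_mul (by positivity) (by positivity)]
  rw [hlog]
  push_cast at e1 e2 e4 e5
  rw [Real.log_mul (by positivity) (by positivity)] at e1 e2 e4
  simp only [mul_one] at e5
  refine le_of_mul_le_mul_left ?_ hM
  linarith

/-- Fano's inequality for all partitions. -/
lemma logMix_le_of_decoder [Nonempty ι] [DecidableEq ι] [MeasurableSpace ι] [MeasurableSingletonClass ι]
    {dec : (Fin n → ℝ) → ι} (hdec : Measurable dec) {σ : Type*} [DecidableEq σ] (S : ι → σ) :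
    logMix 1 x S ≤ Fintype.card ι *
      ((Real.log 2 + (∑ w, (noise n 1).real {z | dec (x w + z) ≠ w}) / Fintype.card ι *
        Real.log (Fintype.card ι)) - n / 2 * (Real.log (2 * Real.pi) + 1)) := by
  have hM : (0 : ℝ) < Fintype.card ι := by exact_mod_cast Fintype.card_pos
  have h := (logMix_le_logMix_unit x S one_ne_zero).trans
    (logMix_unit_le_of_decoder x one_ne_zero fun w => hdec (measurableSet_singleton w))
  have h2 := integral_log_noiseDensity one_ne_zero 1 (0 : Fin n → ℝ) 1
  simp only [zero_add, one_smul] at h2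
  simp only [h2, Finset.sum_const, Finset.card_univ, nsmul_eq_mul] at h
  refine h.trans (le_of_eq ?_)
  simp [normSq]
  field_simp
  ring

/-! ### Conditional means and covariances given the conference. -/

section CondMean

variable {ρ : Type*} [DecidableEq ρ] (T : ι → ρ) (X X' : ι → Fin n → ℝ)

/-- Mean of `X` over a fiber of `T`. -/
def condMean (t : ρ) (i : Fin n) : ℝ :=
  (∑ w with T w = t, X w i) / (Finset.univ.filter (T · = t)).card

/-- Normalised inner product. -/
def avg (X X' : ι → Fin n → ℝ) : ℝ := (∑ w, ∑ i, X w i * X' w i) / (Fintype.card ι * n)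

/-- Orthogonality: on each fiber of T the residual sums to zero while `f ∘ T` is constant. -/
lemma sum_sub_condMean_mul (f : ρ → Fin n → ℝ) :
    ∑ w, ∑ i, (X w i - condMean T X (T w) i) * f (T w) i = 0 := by
  rw [Finset.sum_comm]
  refine Finset.sum_eq_zero fun i _ => ?_
  classical
  rw [← Finset.sum_fiberwise_of_maps_to (s := Finset.univ) (t := Finset.univ.image T)
    (g := T) (fun w _ => Finset.mem_image_of_mem _ (Finset.mem_univ w))]
  refine Finset.sum_eq_zero fun t ht => ?_
  obtain ⟨w₀, -, rfl⟩ := Finset.mem_image.1 ht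
  have : ∀ w ∈ Finset.univ.filter (T · = T w₀), (X w i - condMean T X (T w) i) * f (T w) i =
      (X w i - condMean T X (T w₀) i) * f (T w₀) i := fun w hw => by
    rw [(Finset.mem_filter.1 hw).2]
  rw [Finset.sum_congr rfl this, ← Finset.sum_mul, Finset.sum_sub_distrib]
  have hc : ((Finset.univ.filter (T · = T w₀)).card : ℝ) ≠ 0 := by
    exact_mod_cast (Finset.card_pos.2 ⟨w₀, by simp⟩).ne'
  simp only [Finset.sum_const, nsmul_eq_mul, condMean]
  rw [mul_div_cancel₀ _ hc, sub_self, zero_mul]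

/-- Law of total covariance; both cross terms vanish by orthogonality. -/
lemma avg_eq_add (T : ι → ρ) (X X' : ι → Fin n → ℝ) :
    avg X X' = avg (fun w => X w - condMean T X (T w)) (fun w => X' w - condMean T X' (T w)) +
      avg (fun w => condMean T X (T w)) (fun w => condMean T X' (T w)) := by
  unfold avg
  rw [← add_div]
  congr 1
  have h1 := sum_sub_condMean_mul T X (condMean T X')
  have h2 := sum_sub_condMean_mul T X' (condMean T X)
  rw [← Finset.sum_add_distrib]
  have : ∑ w, ∑ i, X w i * X' w i = ∑ w, (∑ i, (X w - condMean T X (T w)) i *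
      (X' w - condMean T X' (T w)) i + ∑ i, condMean T X (T w) i * condMean T X' (T w) i) +
      ∑ w, ∑ i, (X w i - condMean T X (T w) i) * condMean T X' (T w) i +
      ∑ w, ∑ i, (X' w i - condMean T X' (T w) i) * condMean T X (T w) i := by
    simp only [← Finset.sum_add_distrib]
    refine Finset.sum_congr rfl fun w _ => Finset.sum_congr rfl fun i _ => ?_
    simp only [Pi.sub_apply]
    ring
  rw [this, h1, h2, add_zero, add_zero]

lemma avg_self_nonneg (X : ι → Fin n → ℝ) : 0 ≤ avg X X :=
  div_nonneg (Finset.sum_nonneg fun _ _ => Finset.sum_nonneg fun _ _ => mul_self_nonneg _)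
    (by positivity)

lemma avg_sq_le (X X' : ι → Fin n → ℝ) : avg X X' ^ 2 ≤ avg X X * avg X' X' := by
  unfold avg
  rw [div_pow, div_mul_div_comm, ← sq]
  refine div_le_div_of_nonneg_right ?_ (by positivity)
  rw [← Fintype.sum_prod_type' (f := fun w i => X w i * X' w i),
    ← Fintype.sum_prod_type' (f := fun w i => X w i * X w i),
    ← Fintype.sum_prod_type' (f := fun w i => X' w i * X' w i)]
  simp only [← sq]
  exact Finset.sum_mul_sq_le_sq_mul_sq _ (fun p : ι × Fin n => X p.1 p.2) (fun p => X' p.1 p.2)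

lemma sum_normSq_add_smul [Nonempty ι] (hn : n ≠ 0) (a b : ℝ) (X X' : ι → Fin n → ℝ) :
    ∑ w, normSq (a • X w + b • X' w) = Fintype.card ι * (n *
      (a ^ 2 * avg X X + 2 * a * b * avg X X' + b ^ 2 * avg X' X')) := by
  have hM : (0 : ℝ) < Fintype.card ι := by exact_mod_cast Fintype.card_pos
  have hn' : (0 : ℝ) < n := by positivity
  have : ∑ w, normSq (a • X w + b • X' w) = a ^ 2 * (∑ w, ∑ i, X w i * X w i) +
      2 * a * b * (∑ w, ∑ i, X w i * X' w i) + b ^ 2 * ∑ w, ∑ i, X' w i * X' w i := by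
    simp only [normSq, Finset.mul_sum, ← Finset.sum_add_distrib]
    refine Finset.sum_congr rfl fun w _ => Finset.sum_congr rfl fun i _ => ?_
    simp only [Pi.add_apply, Pi.smul_apply, smul_eq_mul]
    ring
  rw [this]
  unfold avg
  field_simp

end CondMean

end CRAN
end

/-! ### The converse bounds for a single code. -/

noncomputable section

open scoped NNReal ENNReal

namespace CRAN

/-- The converse bounds in terms of the conditional covariances `k₁`, `k₂`, `k` of the channel inputs
given the conference, and the powers `q₁`, `q₂` of their conditional means. -/
structure Feasible (C₁ C₂ C₁₂ C₂₁ P₁ P₂ R k₁ k₂ k q₁ q₂ : ℝ) : Prop where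
  k₁_nonneg : 0 ≤ k₁
  k₂_nonneg : 0 ≤ k₂
  q₁_nonneg : 0 ≤ q₁
  q₂_nonneg : 0 ≤ q₂
  sq_le : k ^ 2 ≤ k₁ * k₂
  power₁ : k₁ + q₁ ≤ P₁
  power₂ : k₂ + q₂ ≤ P₂
  cloud : R ≤ C₁ + C₂
  side₁ : ∀ a, R ≤ C₁ + C₁₂ + 1 / 2 * Real.logb 2 (1 + (k₂ - 2 * a * k + a ^ 2 * k₁))
  side₂ : ∀ a, R ≤ C₂ + C₂₁ + 1 / 2 * Real.logb 2 (1 + (k₁ - 2 * a * k + a ^ 2 * k₂))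
  full : R ≤ 1 / 2 * Real.logb 2 (1 + (P₁ + P₂ + 2 * (k + √(q₁ * q₂))))
  coop : R ≤ C₁₂ + C₂₁ + 1 / 2 * Real.logb 2 (1 + (k₁ + k₂ + 2 * k))
  double : ∀ a b N, 0 ≤ N → R ≤ 1 / 2 * (C₁ + C₂ + C₁₂ + C₂₁ + 1 / 2 * Real.logb 2
    ((1 + (k₁ + k₂ + 2 * k)) * (1 + N + (k₂ - 2 * a * k + a ^ 2 * k₁)) *
      (1 + N + (k₁ - 2 * b * k + b ^ 2 * k₂)) / ((1 + N) * (N + (1 + (k₁ + k₂ + 2 * k))))))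

/-- This is the quadratic form with entries k₁, k, k₂ at the vector (-a, 1), and `h` makes it
positive semidefinite. If k₁ = 0 then k = 0 as well. -/
lemma quadratic_nonneg {k₁ k₂ k : ℝ} (h₁ : 0 ≤ k₁) (h₂ : 0 ≤ k₂) (h : k ^ 2 ≤ k₁ * k₂) (a : ℝ) :
    0 ≤ k₂ - 2 * a * k + a ^ 2 * k₁ := by
  rcases h₁.eq_or_lt with rfl | h₁
  · have : k = 0 := by nlinarith
    simpa [this] using h₂
  · have : k₁ * (k₂ - 2 * a * k + a ^ 2 * k₁) = (k₁ * k₂ - k ^ 2) + (k - a * k₁) ^ 2 := by ring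
    have h3 : 0 ≤ k₁ * (k₂ - 2 * a * k + a ^ 2 * k₁) := by
      rw [this]; nlinarith [sq_nonneg (k - a * k₁)]
    exact nonneg_of_mul_nonneg_right h3 h₁

namespace Code

variable {n M L₁ L₂ L₁₂ L₂₁ : ℕ} (c : Code n M L₁ L₂ L₁₂ L₂₁)

/-- What BS 1 knows after the conference. -/
def view₁ (w : Fin M) : Fin L₁ × ((k : Fin c.rounds) → Fin (c.size₁₂ k)) :=
  (c.cloud₁ w, fun k => (c.transcript (c.cloud₁ w) (c.cloud₂ w) k).1)

/-- What BS 2 knows after the conference. -/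
def view₂ (w : Fin M) : Fin L₂ × ((k : Fin c.rounds) → Fin (c.size₂₁ k)) :=
  (c.cloud₂ w, fun k => (c.transcript (c.cloud₁ w) (c.cloud₂ w) k).2)

/-- The symbols exchanged in the conference. -/
def conference (w : Fin M) :
    ((k : Fin c.rounds) → Fin (c.size₁₂ k)) × ((k : Fin c.rounds) → Fin (c.size₂₁ k)) :=
  ((c.view₁ w).2, (c.view₂ w).2)

/-- The conference as reconstructed by BS 1. -/
def recall₁ (s : Fin L₁ × ((k : Fin c.rounds) → Fin (c.size₁₂ k))) :
    ((k : Fin c.rounds) → Fin (c.size₁₂ k)) × ((k : Fin c.rounds) → Fin (c.size₂₁ k)) :=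
  (s.2, fun k => c.confer₁ k s.1 fun j _ => s.2 j)

/-- The conference as reconstructed by BS 2. -/
def recall₂ (s : Fin L₂ × ((k : Fin c.rounds) → Fin (c.size₂₁ k))) :
    ((k : Fin c.rounds) → Fin (c.size₁₂ k)) × ((k : Fin c.rounds) → Fin (c.size₂₁ k)) :=
  (fun k => c.confer₂ k s.1 fun j _ => s.2 j, s.2)

/-- What BS 1 sends is computed from its index and what it has received, so its view determines the
whole conference. Hence T is a function of each view, however many rounds there are. -/
lemma recall₁_view₁ (w : Fin M) : c.recall₁ (c.view₁ w) = c.conference w := by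
  refine Prod.ext rfl (funext fun k => ?_)
  simp only [recall₁, conference, view₁, view₂]
  conv_rhs => rw [transcript]

lemma recall₂_view₂ (w : Fin M) : c.recall₂ (c.view₂ w) = c.conference w := by
  refine Prod.ext (funext fun k => ?_) rfl
  simp only [recall₂, conference, view₁, view₂]
  conv_rhs => rw [transcript]

lemma input₁_eq (w : Fin M) : c.input₁ w = c.enc₁ (c.view₁ w).1 (c.view₁ w).2 := rfl

lemma input₂_eq (w : Fin M) : c.input₂ w = c.enc₂ (c.view₂ w).1 (c.view₂ w).2 := rfl

lemma errorProb_le_one : c.errorProb ≤ 1 := by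
  unfold errorProb
  refine div_le_one_of_le₀ ?_ (by positivity)
  calc _ ≤ ∑ _w : Fin M, (1 : ℝ) := Finset.sum_le_sum fun w _ => measureReal_le_one
    _ = M := by simp

/-- Each field comes from one choice of side information and an estimate of x from it. The rate is
lowered by the Fano loss, which vanishes with n. -/
theorem feasible (hn : n ≠ 0) (hM : M ≠ 0) {C₁ C₂ C₁₂ C₂₁ P₁ P₂ R : ℝ}
    (hL₁ : (L₁ : ℝ) ≤ 2 ^ (n * C₁)) (hL₂ : (L₂ : ℝ) ≤ 2 ^ (n * C₂))
    (hL₁₂ : (L₁₂ : ℝ) ≤ 2 ^ (n * C₁₂)) (hL₂₁ : (L₂₁ : ℝ) ≤ 2 ^ (n * C₂₁))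
    (hR : (2 : ℝ) ^ (n * R) ≤ M) (hP : c.PowerConstraint P₁ P₂) :
    ∃ k₁ k₂ k q₁ q₂, Feasible C₁ C₂ C₁₂ C₂₁ P₁ P₂ (R * (1 - c.errorProb) - 1 / n)
      k₁ k₂ k q₁ q₂ := by
  have hMne : Nonempty (Fin M) := ⟨⟨0, Nat.pos_of_ne_zero hM⟩⟩
  have hM' : (0 : ℝ) < M := by positivity
  have hn' : (0 : ℝ) < n := by positivity
  have hlog2 : 0 < Real.log 2 := Real.log_pos (by norm_num)
  have hnl : 0 < n * Real.log 2 := by positivity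
  set δ : ℝ := Real.log 2 + c.errorProb * Real.log M with hδ
  set X₁ := c.input₁
  set X₂ := c.input₂
  set T := c.conference
  set x : Fin M → Fin n → ℝ := fun w => X₁ w + X₂ w with hx
  set m₁ := condMean T X₁
  set m₂ := condMean T X₂
  set D₁ : Fin M → Fin n → ℝ := fun w => X₁ w - m₁ (T w)
  set D₂ : Fin M → Fin n → ℝ := fun w => X₂ w - m₂ (T w)
  set k₁ := avg D₁ D₁
  set k₂ := avg D₂ D₂
  set k := avg D₁ D₂
  set q₁ := avg (fun w => m₁ (T w)) (fun w => m₁ (T w))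
  set q₂ := avg (fun w => m₂ (T w)) (fun w => m₂ (T w))
  set q := avg (fun w => m₁ (T w)) (fun w => m₂ (T w))
  have hk₁ : 0 ≤ k₁ := avg_self_nonneg _
  have hk₂ : 0 ≤ k₂ := avg_self_nonneg _
  have hq₁ : 0 ≤ q₁ := avg_self_nonneg _
  have hq₂ : 0 ≤ q₂ := avg_self_nonneg _
  have hk : k ^ 2 ≤ k₁ * k₂ := avg_sq_le _ _
  have hk' : k ^ 2 ≤ k₂ * k₁ := by linarith [mul_comm k₁ k₂]
  have hq : q ≤ √(q₁ * q₂) := Real.le_sqrt_of_sq_le (avg_sq_le _ _)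
  have hX₁ : avg X₁ X₁ = k₁ + q₁ := avg_eq_add T X₁ X₁
  have hX₂ : avg X₂ X₂ = k₂ + q₂ := avg_eq_add T X₂ X₂
  have hX₁₂ : avg X₁ X₂ = k + q := avg_eq_add T X₁ X₂
  have hpow : ∀ {X : Fin M → Fin n → ℝ} {P : ℝ}, (∑ w, ∑ i, X w i ^ 2) / M ≤ n * P →
      avg X X ≤ P := fun {X P} h => by
    unfold avg
    simp only [Fintype.card_fin, ← sq]
    rw [← div_div, div_le_iff₀ hn']
    linarith
  have hp₁ := hpow hP.1
  have hp₂ := hpow hP.2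
  have hF : ∀ {σ : Type} [DecidableEq σ] (S : Fin M → σ), logMix 1 x S ≤
      Fintype.card (Fin M) * (δ - n / 2 * (Real.log (2 * Real.pi) + 1)) := fun S => by
    have := logMix_le_of_decoder (x := x) c.measurable_dec S
    simpa only [Fintype.card_fin, hδ, errorProb, noise] using this
  -- In the Fano term δ, the summand log 2 becomes 1 / n and the summand in log M becomes the factor
  -- 1 - `errorProb`.
  have hrate : n * Real.log 2 * (R * (1 - c.errorProb) - 1 / n) ≤ Real.log M - δ := by
    have h1 : n * R * Real.log 2 ≤ Real.log M := by
      rw [← Real.log_rpow (by norm_num)]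
      exact Real.log_le_log (by positivity) hR
    have h2 := mul_le_mul_of_nonneg_right h1 (sub_nonneg.2 c.errorProb_le_one)
    have h3 : n * Real.log 2 * (R * (1 - c.errorProb) - 1 / n) =
        n * R * Real.log 2 * (1 - c.errorProb) - Real.log 2 := by field_simp
    rw [h3, hδ]
    linarith
  have hcard : ∀ {K : ℕ} {A B : ℝ}, K ≠ 0 → (K : ℝ) ≤ 2 ^ (n * A) * 2 ^ (n * B) →
      Real.log K ≤ n * Real.log 2 * (A + B) := fun {K A B} hK h => by
    have := Real.log_le_log (by positivity) h
    rw [Real.log_mul (by positivity) (by positivity), Real.log_rpow (by norm_num),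
      Real.log_rpow (by norm_num)] at this
    linarith
  have hlogb : ∀ A, n / 2 * Real.log A = n * Real.log 2 * (1 / 2 * Real.logb 2 A) := fun A => by
    rw [Real.logb]; field_simp
  have w₀ : Fin M := Classical.arbitrary _
  have hs₁₂ : ((∏ k, c.size₁₂ k : ℕ) : ℝ) ≤ 2 ^ (n * C₁₂) :=
    le_trans (by exact_mod_cast c.prod_size₁₂_le) hL₁₂
  have hs₂₁ : ((∏ k, c.size₂₁ k : ℕ) : ℝ) ≤ 2 ^ (n * C₂₁) :=
    le_trans (by exact_mod_cast c.prod_size₂₁_le) hL₂₁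
  have card₁ : Real.log (Fintype.card (Fin L₁ × ((k : Fin c.rounds) → Fin (c.size₁₂ k)))) ≤
      n * Real.log 2 * (C₁ + C₁₂) := by
    refine hcard (Fintype.card_pos_iff.2 ⟨c.view₁ w₀⟩).ne' ?_
    simp only [Fintype.card_prod, Fintype.card_pi, Fintype.card_fin, Nat.cast_mul]
    gcongr
  have card₂ : Real.log (Fintype.card (Fin L₂ × ((k : Fin c.rounds) → Fin (c.size₂₁ k)))) ≤
      n * Real.log 2 * (C₂ + C₂₁) := by
    refine hcard (Fintype.card_pos_iff.2 ⟨c.view₂ w₀⟩).ne' ?_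
    simp only [Fintype.card_prod, Fintype.card_pi, Fintype.card_fin, Nat.cast_mul]
    gcongr
  have cardT : Real.log (Fintype.card (((k : Fin c.rounds) → Fin (c.size₁₂ k)) ×
      ((k : Fin c.rounds) → Fin (c.size₂₁ k)))) ≤ n * Real.log 2 * (C₁₂ + C₂₁) := by
    refine hcard (Fintype.card_pos_iff.2 ⟨T w₀⟩).ne' ?_
    simp only [Fintype.card_prod, Fintype.card_pi, Fintype.card_fin, Nat.cast_mul]
    gcongr
  have cardL : Real.log (Fintype.card (Fin L₁ × Fin L₂)) ≤ n * Real.log 2 * (C₁ + C₂) := by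
    refine hcard (Fintype.card_pos_iff.2 ⟨(c.cloud₁ w₀, c.cloud₂ w₀)⟩).ne' ?_
    simp only [Fintype.card_prod, Fintype.card_fin, Nat.cast_mul]
    gcongr
  -- BS 1 knows its own input and the conference, so it estimates the other input by its conditional
  -- mean plus a multiple of its own residual. The error is D₂ - a D₁; `a` stays free and is chosen
  -- only with the correlations.
  set z₁ : ℝ → Fin L₁ × ((k : Fin c.rounds) → Fin (c.size₁₂ k)) → Fin n → ℝ := fun a s =>
    c.enc₁ s.1 s.2 + m₂ (c.recall₁ s) + a • (c.enc₁ s.1 s.2 - m₁ (c.recall₁ s))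
  set z₂ : ℝ → Fin L₂ × ((k : Fin c.rounds) → Fin (c.size₂₁ k)) → Fin n → ℝ := fun a s =>
    c.enc₂ s.1 s.2 + m₁ (c.recall₂ s) + a • (c.enc₂ s.1 s.2 - m₂ (c.recall₂ s))
  have hv₁ : ∀ a, ∑ w, normSq (x w - z₁ a (c.view₁ w)) =
      Fintype.card (Fin M) * (n * (k₂ - 2 * a * k + a ^ 2 * k₁)) := fun a => by
    have : ∀ w, x w - z₁ a (c.view₁ w) = (-a) • D₁ w + (1 : ℝ) • D₂ w := fun w => by
      simp only [hx, z₁, D₁, D₂, recall₁_view₁, ← input₁_eq]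
      ext i; simp [X₁, T]; ring
    simp only [this]
    rw [sum_normSq_add_smul hn]
    ring
  have hv₂ : ∀ a, ∑ w, normSq (x w - z₂ a (c.view₂ w)) =
      Fintype.card (Fin M) * (n * (k₁ - 2 * a * k + a ^ 2 * k₂)) := fun a => by
    have : ∀ w, x w - z₂ a (c.view₂ w) = (1 : ℝ) • D₁ w + (-a) • D₂ w := fun w => by
      simp only [hx, z₂, D₁, D₂, recall₂_view₂, ← input₂_eq]
      ext i; simp [X₂, T]; ring
    simp only [this]
    rw [sum_normSq_add_smul hn]
    ring
  have hvT : ∑ w, normSq (x w - (fun t => m₁ t + m₂ t) (T w)) =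
      Fintype.card (Fin M) * (n * (k₁ + k₂ + 2 * k)) := by
    have : ∀ w, x w - (fun t => m₁ t + m₂ t) (T w) = (1 : ℝ) • D₁ w + (1 : ℝ) • D₂ w :=
      fun w => by
        simp only [hx, D₁, D₂]
        ext i; simp; ring
    simp only [this]
    rw [sum_normSq_add_smul hn]
    ring
  have hqT : 0 ≤ k₁ + k₂ + 2 * k := by
    have := quadratic_nonneg hk₁ hk₂ hk (-1); linarith
  refine ⟨k₁, k₂, k, q₁, q₂, hk₁, hk₂, hq₁, hq₂, hk, by linarith, by linarith, ?_, fun a => ?_,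
    fun a => ?_, ?_, ?_, fun a b N hN => ?_⟩ <;> refine le_of_mul_le_mul_left (hrate.trans ?_) hnl
  -- The two CP indices determine the conference and both inputs, so the estimate is exact and v =
  -- 0.
  · have := log_card_le_of_center (x := x) (fun w => (c.cloud₁ w, c.cloud₂ w)) (hF _)
      (fun l => c.enc₁ l.1 (fun k => (c.transcript l.1 l.2 k).1) +
        c.enc₂ l.2 (fun k => (c.transcript l.1 l.2 k).2)) le_rfl
      (by simp [hx, X₁, X₂, input₁, input₂, normSq])
    simp only [add_zero, Real.log_one, mul_zero] at this
    rw [Fintype.card_fin] at this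
    linarith
  · have := log_card_le_of_center (x := x) c.view₁ (hF _) (z₁ a) (quadratic_nonneg hk₁ hk₂ hk a)
      (hv₁ a).le
    rw [hlogb, Fintype.card_fin] at this
    linarith
  · have := log_card_le_of_center (x := x) c.view₂ (hF _) (z₂ a) (quadratic_nonneg hk₂ hk₁ hk' a)
      (hv₂ a).le
    rw [hlogb, Fintype.card_fin] at this
    linarith
  · have hsum : ∑ w, normSq (x w) = M * (n * (avg X₁ X₁ + 2 * avg X₁ X₂ + avg X₂ X₂)) := by
      have h := sum_normSq_add_smul hn 1 1 X₁ X₂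
      simp only [one_smul, Fintype.card_fin] at h
      rw [show ∑ w, normSq (x w) = _ from h]
      ring
    -- The correlation of the inputs splits into k and the correlation q of the conditional means,
    -- and q is bounded by Cauchy–Schwarz.
    have hle : avg X₁ X₁ + 2 * avg X₁ X₂ + avg X₂ X₂ ≤ P₁ + P₂ + 2 * (k + √(q₁ * q₂)) := by
      linarith
    have hnn : 0 ≤ avg X₁ X₁ + 2 * avg X₁ X₂ + avg X₂ X₂ := by
      have : 0 ≤ ∑ w, normSq (x w) := Finset.sum_nonneg fun _ _ => normSq_nonneg _
      rw [hsum] at this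
      exact nonneg_of_mul_nonneg_right (nonneg_of_mul_nonneg_right this hM') hn'
    have := log_card_le_of_center (x := x) (fun _ => ()) (hF _) (fun _ => 0) (hnn.trans hle)
      (by simp only [sub_zero, Fintype.card_fin, hsum]; gcongr)
    rw [hlogb, Fintype.card_fin] at this
    simp only [Fintype.card_unit, Nat.cast_one, Real.log_one] at this
    linarith
  · have := log_card_le_of_center (x := x) T (hF _) (fun t => m₁ t + m₂ t) hqT hvT.le
    rw [hlogb, Fintype.card_fin] at this
    linarith
  · have := two_mul_log_card_le (x := x) c.view₁ c.view₂ T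
      (fun w w' h => by simp only [T, ← recall₁_view₁, h])
      (fun w w' h => by simp only [T, ← recall₂_view₂, h])
      (fun w w' h h' => by simp only [hx, X₁, X₂, input₁_eq, input₂_eq, h, h'])
      (hF _) (hF _) (z₁ a) (z₂ b) (fun t => m₁ t + m₂ t)
      (quadratic_nonneg hk₁ hk₂ hk a) (quadratic_nonneg hk₂ hk₁ hk' b) hqT hN
      (hv₁ a).le (hv₂ b).le hvT.le
    rw [hlogb, Fintype.card_fin] at this
    linarith

end Code

end CRAN
end

/-! ### Passage to the limit of large block length. -/

noncomputable section

open scoped NNReal ENNReal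

namespace CRAN

lemma Feasible.sum_nonneg {C₁ C₂ C₁₂ C₂₁ P₁ P₂ R k₁ k₂ k q₁ q₂ : ℝ}
    (h : Feasible C₁ C₂ C₁₂ C₂₁ P₁ P₂ R k₁ k₂ k q₁ q₂) : 0 ≤ k₁ + k₂ + 2 * k := by
  have := quadratic_nonneg h.k₁_nonneg h.k₂_nonneg h.sq_le (-1)
  linarith

lemma Feasible.abs_le {C₁ C₂ C₁₂ C₂₁ P₁ P₂ R k₁ k₂ k q₁ q₂ : ℝ}
    (h : Feasible C₁ C₂ C₁₂ C₂₁ P₁ P₂ R k₁ k₂ k q₁ q₂) : |k| ≤ P₁ + P₂ := by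
  have := h.k₁_nonneg
  have := h.k₂_nonneg
  have := h.q₁_nonneg
  have := h.q₂_nonneg
  have := h.power₁
  have := h.power₂
  refine abs_le_of_sq_le_sq (h.sq_le.trans ?_) (by linarith)
  nlinarith

/-- The converse bounds are closed under limits. -/
lemma Feasible.of_tendsto {C₁ C₂ C₁₂ C₂₁ P₁ P₂ R k₁ k₂ k q₁ q₂ : ℝ}
    {R' k₁' k₂' k' q₁' q₂' : ℕ → ℝ}
    (h : ∀ j, Feasible C₁ C₂ C₁₂ C₂₁ P₁ P₂ (R' j) (k₁' j) (k₂' j) (k' j) (q₁' j) (q₂' j))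
    (hR : Tendsto R' atTop (𝓝 R)) (hk₁ : Tendsto k₁' atTop (𝓝 k₁))
    (hk₂ : Tendsto k₂' atTop (𝓝 k₂)) (hk : Tendsto k' atTop (𝓝 k))
    (hq₁ : Tendsto q₁' atTop (𝓝 q₁)) (hq₂ : Tendsto q₂' atTop (𝓝 q₂)) :
    Feasible C₁ C₂ C₁₂ C₂₁ P₁ P₂ R k₁ k₂ k q₁ q₂ := by
  have h₁ : 0 ≤ k₁ := ge_of_tendsto' hk₁ fun j => (h j).k₁_nonneg
  have h₂ : 0 ≤ k₂ := ge_of_tendsto' hk₂ fun j => (h j).k₂_nonneg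
  have h₃ : 0 ≤ q₁ := ge_of_tendsto' hq₁ fun j => (h j).q₁_nonneg
  have h₄ : 0 ≤ q₂ := ge_of_tendsto' hq₂ fun j => (h j).q₂_nonneg
  have h₅ : k ^ 2 ≤ k₁ * k₂ := le_of_tendsto_of_tendsto' (hk.pow 2) (hk₁.mul hk₂)
    fun j => (h j).sq_le
  have h₅' : k ^ 2 ≤ k₂ * k₁ := by linarith [mul_comm k₁ k₂]
  have hp₁ : k₁ + q₁ ≤ P₁ := le_of_tendsto' (hk₁.add hq₁) fun j => (h j).power₁
  have hp₂ : k₂ + q₂ ≤ P₂ := le_of_tendsto' (hk₂.add hq₂) fun j => (h j).power₂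
  have hs := quadratic_nonneg h₁ h₂ h₅ (-1)
  have hv₁ := quadratic_nonneg h₁ h₂ h₅
  have hv₂ := quadratic_nonneg h₂ h₁ h₅'
  have hlog : ∀ {u : ℕ → ℝ} {l : ℝ}, 0 < l → Tendsto u atTop (𝓝 l) →
      Tendsto (fun j => Real.logb 2 (u j)) atTop (𝓝 (Real.logb 2 l)) := fun hl hu =>
    (Real.continuousAt_logb hl.ne').tendsto.comp hu
  have t₁ : ∀ a : ℝ, Tendsto (fun j => k₂' j - 2 * a * k' j + a ^ 2 * k₁' j) atTop
      (𝓝 (k₂ - 2 * a * k + a ^ 2 * k₁)) := fun a =>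
    (hk₂.sub (hk.const_mul _)).add (hk₁.const_mul _)
  have t₂ : ∀ a : ℝ, Tendsto (fun j => k₁' j - 2 * a * k' j + a ^ 2 * k₂' j) atTop
      (𝓝 (k₁ - 2 * a * k + a ^ 2 * k₂)) := fun a =>
    (hk₁.sub (hk.const_mul _)).add (hk₂.const_mul _)
  have t₃ : Tendsto (fun j => k₁' j + k₂' j + 2 * k' j) atTop (𝓝 (k₁ + k₂ + 2 * k)) :=
    (hk₁.add hk₂).add (hk.const_mul _)
  refine ⟨h₁, h₂, h₃, h₄, h₅, hp₁, hp₂, le_of_tendsto' hR fun j => (h j).cloud, fun a => ?_,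
    fun a => ?_, ?_, ?_, fun a b N hN => ?_⟩
  · exact le_of_tendsto_of_tendsto' hR (((hlog (by linarith [hv₁ a])
      ((t₁ a).const_add 1)).const_mul _).const_add _) fun j => (h j).side₁ a
  · exact le_of_tendsto_of_tendsto' hR (((hlog (by linarith [hv₂ a])
      ((t₂ a).const_add 1)).const_mul _).const_add _) fun j => (h j).side₂ a
  · refine le_of_tendsto_of_tendsto' hR ((hlog ?_
      (((hk.add (hq₁.mul hq₂).sqrt).const_mul 2).const_add (P₁ + P₂) |>.const_add 1)).const_mul _)
      fun j => (h j).full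
    linarith [Real.sqrt_nonneg (q₁ * q₂)]
  · exact le_of_tendsto_of_tendsto' hR (((hlog (by linarith)
      (t₃.const_add 1)).const_mul _).const_add _) fun j => (h j).coop
  · have h6 : 0 < 1 + (k₁ + k₂ + 2 * k) := by linarith
    have h7 : 0 < 1 + N + (k₂ - 2 * a * k + a ^ 2 * k₁) := by linarith [hv₁ a]
    have h8 : 0 < 1 + N + (k₁ - 2 * b * k + b ^ 2 * k₂) := by linarith [hv₂ b]
    have h9 : 0 < (1 + N) * (N + (1 + (k₁ + k₂ + 2 * k))) := by positivity
    exact le_of_tendsto_of_tendsto' hR ((((hlog (by positivity)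
      ((((t₃.const_add 1).mul ((t₁ a).const_add (1 + N))).mul ((t₂ b).const_add (1 + N))).div
        (((t₃.const_add 1).const_add N).const_mul (1 + N)) h9.ne')).const_mul _).const_add
          _).const_mul _) fun j => (h j).double a b N hN

/-- The parameters of all codes lie in a fixed compact box, so a subsequence converges. The bounds
are closed under limits, and the lowered rates tend to R. -/
lemma Achievable.feasible {C₁ C₂ C₁₂ C₂₁ P₁ P₂ R : ℝ} (h : Achievable C₁ C₂ C₁₂ C₂₁ P₁ P₂ R) :
    ∃ k₁ k₂ k q₁ q₂, Feasible C₁ C₂ C₁₂ C₂₁ P₁ P₂ R k₁ k₂ k q₁ q₂ := by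
  obtain ⟨c, hP, hE⟩ := h
  have hfl : ∀ (n : ℕ) (C : ℝ), ((⌊(2 : ℝ) ^ (n * C)⌋₊ : ℕ) : ℝ) ≤ 2 ^ (n * C) := fun n C =>
    Nat.floor_le (by positivity)
  -- The shift to n + 1 avoids block length zero, where normalising by n is meaningless.
  have hf := fun n : ℕ => (c (n + 1)).feasible (Nat.succ_ne_zero n)
    (Nat.ceil_pos.2 (by positivity)).ne' (hfl _ _) (hfl _ _) (hfl _ _) (hfl _ _)
    (Nat.le_ceil _) (hP (n + 1))
  choose k₁ k₂ k q₁ q₂ hf using hf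
  set u : ℕ → ℝ × ℝ × ℝ × ℝ × ℝ := fun j => (k₁ j, k₂ j, k j, q₁ j, q₂ j)
  have hu : ∀ j, u j ∈ Set.Icc ((0, 0, -(P₁ + P₂), 0, 0) : ℝ × ℝ × ℝ × ℝ × ℝ)
      (P₁, P₂, P₁ + P₂, P₁, P₂) := fun j => by
    have h1 := (hf j).k₁_nonneg
    have h2 := (hf j).k₂_nonneg
    have h3 := (hf j).q₁_nonneg
    have h4 := (hf j).q₂_nonneg
    have h5 := (hf j).power₁
    have h6 := (hf j).power₂
    have h7 := _root_.abs_le.1 (hf j).abs_le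
    simp only [u, Set.mem_Icc, Prod.mk_le_mk]
    exact ⟨⟨h1, h2, h7.1, h3, h4⟩, by linarith, by linarith, h7.2, by linarith, by linarith⟩
  obtain ⟨⟨l₁, l₂, l, p₁, p₂⟩, -, φ, hφ, hlim⟩ := isCompact_Icc.tendsto_subseq hu
  simp only [nhds_prod_eq] at hlim
  have e₁ := hlim.fst
  have e₂ := hlim.snd.fst
  have e₃ := hlim.snd.snd.fst
  have e₄ := hlim.snd.snd.snd.fst
  have e₅ := hlim.snd.snd.snd.snd
  refine ⟨l₁, l₂, l, p₁, p₂, Feasible.of_tendsto (fun j => hf (φ j)) ?_ e₁ e₂ e₃ e₄ e₅⟩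
  have hE' := hE.comp (tendsto_add_atTop_nat 1)
  have hn : Tendsto (fun n : ℕ => 1 / ((n + 1 : ℕ) : ℝ)) atTop (𝓝 0) := by
    simpa using tendsto_one_div_add_atTop_nhds_zero_nat (𝕜 := ℝ)
  have := ((hE'.const_sub 1).const_mul R).sub hn
  simp only [sub_zero, mul_one] at this
  exact this.comp hφ.tendsto_atTop

/-! ### From covariances to correlation coefficients. -/

lemma double_mono {u u' v v' w w' N : ℝ} (hu : 0 ≤ u) (hv : 0 ≤ v) (hw : 0 ≤ w) (hN : 0 ≤ N)
    (huu : u ≤ u') (hvv : v ≤ v') (hww : w ≤ w') :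
    (1 + u) * (1 + N + v) * (1 + N + w) / ((1 + N) * (N + (1 + u))) ≤
      (1 + u') * (1 + N + v') * (1 + N + w') / ((1 + N) * (N + (1 + u'))) := by
  have hu' := hu.trans huu
  have hv' := hv.trans hvv
  -- The variable u sits in numerator and denominator; the quotient is still increasing in it
  -- because N ≥ 0.
  have h1 : (1 + u) / (N + (1 + u)) ≤ (1 + u') / (N + (1 + u')) := by
    rw [div_le_div_iff₀ (by positivity) (by positivity)]
    nlinarith
  have e : ∀ u v w : ℝ, 0 ≤ u → (1 + u) * (1 + N + v) * (1 + N + w) / ((1 + N) * (N + (1 + u))) =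
      (1 + u) / (N + (1 + u)) * (1 + N + v) * (1 + N + w) / (1 + N) := fun u v w hu => by
    field_simp
  rw [e u v w hu, e u' v' w' hu']
  gcongr

/-- The bounds for given correlation coefficients. -/
lemma Feasible.bounds {C₁ C₂ C₁₂ C₂₁ P₁ P₂ R k₁ k₂ k q₁ q₂ : ℝ}
    (h : Feasible C₁ C₂ C₁₂ C₂₁ P₁ P₂ R k₁ k₂ k q₁ q₂) {ρ ρ₁ ρ₂ a b : ℝ}
    (hρ₁ : 0 < 1 - ρ₁ ^ 2) (hρ₂ : 0 < 1 - ρ₂ ^ 2)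
    (hs : k₁ + k₂ + 2 * k ≤
      (1 - ρ₁ ^ 2) * P₁ + (1 - ρ₂ ^ 2) * P₂ + 2 * (ρ - ρ₁ * ρ₂) * √(P₁ * P₂))
    (ha : k₂ - 2 * a * k + a ^ 2 * k₁ ≤ corrDet ρ ρ₁ ρ₂ * P₂ / (1 - ρ₁ ^ 2))
    (hb : k₁ - 2 * b * k + b ^ 2 * k₂ ≤ corrDet ρ ρ₁ ρ₂ * P₁ / (1 - ρ₂ ^ 2))
    (hf : k + √(q₁ * q₂) ≤ ρ * √(P₁ * P₂)) (N : ℝ) (hN : 0 ≤ N) :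
    R ≤ C₁ + C₂ ∧
    R ≤ C₁ + C₁₂ + 1 / 2 * Real.logb 2
      ((1 - ρ₁ ^ 2 + (1 - ρ ^ 2 - ρ₁ ^ 2 - ρ₂ ^ 2 + 2 * ρ * ρ₁ * ρ₂) * P₂) / (1 - ρ₁ ^ 2)) ∧
    R ≤ C₂ + C₂₁ + 1 / 2 * Real.logb 2
      ((1 - ρ₂ ^ 2 + (1 - ρ ^ 2 - ρ₁ ^ 2 - ρ₂ ^ 2 + 2 * ρ * ρ₁ * ρ₂) * P₁) / (1 - ρ₂ ^ 2)) ∧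
    R ≤ 1 / 2 * Real.logb 2 (1 + P₁ + P₂ + 2 * ρ * √(P₁ * P₂)) ∧
    R ≤ C₁₂ + C₂₁ + 1 / 2 * Real.logb 2
      (1 + (1 - ρ₁ ^ 2) * P₁ + (1 - ρ₂ ^ 2) * P₂ + 2 * (ρ - ρ₁ * ρ₂) * √(P₁ * P₂)) ∧
    R ≤ 1 / 2 * (C₁ + C₂ + C₁₂ + C₂₁ + 1 / 2 * Real.logb 2
      (varphi ρ ρ₁ ρ₂ P₁ P₂ * phi₁ N ρ ρ₁ ρ₂ P₂ * phi₂ N ρ ρ₁ ρ₂ P₁ /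
        ((1 + N) * (1 - ρ₁ ^ 2) * (1 - ρ₂ ^ 2) * (N + varphi ρ ρ₁ ρ₂ P₁ P₂)))) := by
  have hk' : k ^ 2 ≤ k₂ * k₁ := by linarith [h.sq_le, mul_comm k₁ k₂]
  have hv₁ := quadratic_nonneg h.k₁_nonneg h.k₂_nonneg h.sq_le a
  have hv₂ := quadratic_nonneg h.k₂_nonneg h.k₁_nonneg hk' b
  have hu := h.sum_nonneg
  have hlog : ∀ {s t : ℝ}, 0 < s → s ≤ t → Real.logb 2 s ≤ Real.logb 2 t := fun hs hst =>
    Real.logb_le_logb_of_le (by norm_num) hs hst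
  have e₁ : (1 - ρ₁ ^ 2 + (1 - ρ ^ 2 - ρ₁ ^ 2 - ρ₂ ^ 2 + 2 * ρ * ρ₁ * ρ₂) * P₂) / (1 - ρ₁ ^ 2) =
      1 + corrDet ρ ρ₁ ρ₂ * P₂ / (1 - ρ₁ ^ 2) := by
    rw [add_div, div_self hρ₁.ne', corrDet]
  have e₂ : (1 - ρ₂ ^ 2 + (1 - ρ ^ 2 - ρ₁ ^ 2 - ρ₂ ^ 2 + 2 * ρ * ρ₁ * ρ₂) * P₁) / (1 - ρ₂ ^ 2) =
      1 + corrDet ρ ρ₁ ρ₂ * P₁ / (1 - ρ₂ ^ 2) := by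
    rw [add_div, div_self hρ₂.ne', corrDet]
  have e₃ : 1 + (1 - ρ₁ ^ 2) * P₁ + (1 - ρ₂ ^ 2) * P₂ + 2 * (ρ - ρ₁ * ρ₂) * √(P₁ * P₂) =
      1 + ((1 - ρ₁ ^ 2) * P₁ + (1 - ρ₂ ^ 2) * P₂ + 2 * (ρ - ρ₁ * ρ₂) * √(P₁ * P₂)) := by ring
  have e₄ : varphi ρ ρ₁ ρ₂ P₁ P₂ * phi₁ N ρ ρ₁ ρ₂ P₂ * phi₂ N ρ ρ₁ ρ₂ P₁ /
        ((1 + N) * (1 - ρ₁ ^ 2) * (1 - ρ₂ ^ 2) * (N + varphi ρ ρ₁ ρ₂ P₁ P₂)) =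
      varphi ρ ρ₁ ρ₂ P₁ P₂ * (1 + N + corrDet ρ ρ₁ ρ₂ * P₂ / (1 - ρ₁ ^ 2)) *
        (1 + N + corrDet ρ ρ₁ ρ₂ * P₁ / (1 - ρ₂ ^ 2)) /
        ((1 + N) * (N + varphi ρ ρ₁ ρ₂ P₁ P₂)) := by
    have hφ : 0 < N + varphi ρ ρ₁ ρ₂ P₁ P₂ := by rw [varphi]; linarith
    have f₁ : phi₁ N ρ ρ₁ ρ₂ P₂ =
        (1 - ρ₁ ^ 2) * (1 + N + corrDet ρ ρ₁ ρ₂ * P₂ / (1 - ρ₁ ^ 2)) := by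
      rw [phi₁]; field_simp
    have f₂ : phi₂ N ρ ρ₁ ρ₂ P₁ =
        (1 - ρ₂ ^ 2) * (1 + N + corrDet ρ ρ₁ ρ₂ * P₁ / (1 - ρ₂ ^ 2)) := by
      rw [phi₂]; field_simp
    rw [f₁, f₂]
    generalize corrDet ρ ρ₁ ρ₂ * P₂ / (1 - ρ₁ ^ 2) = A
    generalize corrDet ρ ρ₁ ρ₂ * P₁ / (1 - ρ₂ ^ 2) = B
    rw [div_eq_div_iff (by positivity) (by positivity)]
    ring
  refine ⟨h.cloud, ?_, ?_, ?_, ?_, ?_⟩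
  · rw [e₁]
    linarith [h.side₁ a, hlog (by linarith) (add_le_add_right ha 1)]
  · rw [e₂]
    linarith [h.side₂ b, hlog (by linarith) (add_le_add_right hb 1)]
  · have hpos : 0 < 1 + (P₁ + P₂ + 2 * (k + √(q₁ * q₂))) := by
      linarith [h.power₁, h.power₂, h.q₁_nonneg, h.q₂_nonneg, Real.sqrt_nonneg (q₁ * q₂)]
    linarith [h.full, hlog hpos (show 1 + (P₁ + P₂ + 2 * (k + √(q₁ * q₂))) ≤
      1 + P₁ + P₂ + 2 * ρ * √(P₁ * P₂) by linarith)]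
  · rw [e₃]
    linarith [h.coop, hlog (by linarith) (add_le_add_right hs 1)]
  · rw [e₄, varphi, e₃]
    have := h.double a b N hN
    linarith [hlog (by positivity) (double_mono hu hv₁ hv₂ hN hs ha hb)]

/-- Unused power d_i - k_i, with d_i = P_i - q_i, is counted as residual power. With ρ_i² = q_i /
P_i this gives 1 - ρ_i² = d_i / P_i, and the determinant becomes (d₁d₂ - κ²) / (P₁P₂) for residual
covariance κ. -/
lemma Feasible.exists_correlations {C₁ C₂ C₁₂ C₂₁ P₁ P₂ R k₁ k₂ k q₁ q₂ : ℝ}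
    (h : Feasible C₁ C₂ C₁₂ C₂₁ P₁ P₂ R k₁ k₂ k q₁ q₂) :
    ∃ ρ ρ₁ ρ₂ a b : ℝ, 0 ≤ ρ ∧ ρ ≤ 1 ∧ 0 ≤ ρ₁ ∧ ρ₁ < 1 ∧ 0 ≤ ρ₂ ∧ ρ₂ < 1 ∧
      0 ≤ corrDet ρ ρ₁ ρ₂ ∧
      k₁ + k₂ + 2 * k ≤
        (1 - ρ₁ ^ 2) * P₁ + (1 - ρ₂ ^ 2) * P₂ + 2 * (ρ - ρ₁ * ρ₂) * √(P₁ * P₂) ∧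
      k₂ - 2 * a * k + a ^ 2 * k₁ ≤ corrDet ρ ρ₁ ρ₂ * P₂ / (1 - ρ₁ ^ 2) ∧
      k₁ - 2 * b * k + b ^ 2 * k₂ ≤ corrDet ρ ρ₁ ρ₂ * P₁ / (1 - ρ₂ ^ 2) ∧
      k + √(q₁ * q₂) ≤ ρ * √(P₁ * P₂) := by
  have hk₁ := h.k₁_nonneg
  have hk₂ := h.k₂_nonneg
  have hq₁ := h.q₁_nonneg
  have hq₂ := h.q₂_nonneg
  have hp₁ := h.power₁
  have hp₂ := h.power₂
  have hk := h.sq_le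
  have hP₁ : 0 ≤ P₁ := by linarith
  have hP₂ : 0 ≤ P₂ := by linarith
  have hs0 := Real.sqrt_nonneg (P₁ * P₂)
  have hratio : ∀ {q P : ℝ}, 0 ≤ q → q ≤ P → √(q / P) ^ 2 * P = q ∧ √(q / P) ^ 2 ≤ 1 :=
    fun {q P} hq hqP => by
      rw [Real.sq_sqrt (div_nonneg hq (hq.trans hqP))]
      refine ⟨?_, div_le_one_of_le₀ hqP (hq.trans hqP)⟩
      rcases (hq.trans hqP).eq_or_lt with h0 | h0
      · rw [← h0]; linarith
      · exact div_mul_cancel₀ _ h0.ne'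
  obtain ⟨r₁, r₁'⟩ := hratio hq₁ (by linarith : q₁ ≤ P₁)
  obtain ⟨r₂, r₂'⟩ := hratio hq₂ (by linarith : q₂ ≤ P₂)
  have n₁ := Real.sqrt_nonneg (q₁ / P₁)
  have n₂ := Real.sqrt_nonneg (q₂ / P₂)
  -- If q₁ = P₁ the recipe would give ρ₁ = 1 (or 0 / 0 when P₁ = 0). But then k₁ = k = 0, so ρ₁ = ρ₂
  -- = 0 suffices and ρ alone carries the correlation of the conditional means. The case q₂ = P₂ is
  -- symmetric.
  rcases (by linarith : q₁ ≤ P₁).eq_or_lt with h₁ | h₁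
  · have k10 : k₁ = 0 := by linarith
    have k0 : k = 0 := by
      rw [k10, zero_mul] at hk
      exact (pow_eq_zero_iff two_ne_zero).1 (le_antisymm hk (sq_nonneg k))
    refine ⟨√(q₂ / P₂), 0, 0, 0, 0, n₂, (sq_le_one_iff₀ n₂).1 r₂', le_rfl, one_pos, le_rfl, one_pos, ?_, ?_, ?_,
      ?_, ?_⟩
    · rw [corrDet]; linarith
    · have := mul_nonneg n₂ hs0
      rw [k10, k0]; linarith
    · have : corrDet √(q₂ / P₂) 0 0 * P₂ / (1 - 0 ^ 2) = P₂ - √(q₂ / P₂) ^ 2 * P₂ := by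
        rw [corrDet]; ring
      rw [this, r₂]; linarith
    · have : corrDet √(q₂ / P₂) 0 0 * P₁ / (1 - 0 ^ 2) = (1 - √(q₂ / P₂) ^ 2) * P₁ := by
        rw [corrDet]; ring
      rw [this, k10, k0]
      have := mul_nonneg (sub_nonneg.2 r₂') hP₁
      linarith
    · rw [k0, h₁, zero_add, Real.sqrt_mul hP₁, Real.sqrt_mul hP₁, mul_left_comm]
      refine mul_le_mul_of_nonneg_left ?_ (Real.sqrt_nonneg _)
      refine Real.sqrt_le_iff.2 ⟨by positivity, ?_⟩
      rw [mul_pow, Real.sq_sqrt hP₂, r₂]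
  rcases (by linarith : q₂ ≤ P₂).eq_or_lt with h₂ | h₂
  · have k20 : k₂ = 0 := by linarith
    have k0 : k = 0 := by
      rw [k20, mul_zero] at hk
      exact (pow_eq_zero_iff two_ne_zero).1 (le_antisymm hk (sq_nonneg k))
    refine ⟨√(q₁ / P₁), 0, 0, 0, 0, n₁, (sq_le_one_iff₀ n₁).1 r₁', le_rfl, one_pos, le_rfl, one_pos, ?_, ?_, ?_,
      ?_, ?_⟩
    · rw [corrDet]; linarith
    · have := mul_nonneg n₁ hs0
      rw [k20, k0]; linarith
    · have : corrDet √(q₁ / P₁) 0 0 * P₂ / (1 - 0 ^ 2) = (1 - √(q₁ / P₁) ^ 2) * P₂ := by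
        rw [corrDet]; ring
      rw [this, k20, k0]
      have := mul_nonneg (sub_nonneg.2 r₁') hP₂
      linarith
    · have : corrDet √(q₁ / P₁) 0 0 * P₁ / (1 - 0 ^ 2) = P₁ - √(q₁ / P₁) ^ 2 * P₁ := by
        rw [corrDet]; ring
      rw [this, r₁]; linarith
    · rw [k0, h₂, zero_add, Real.sqrt_mul hq₁, Real.sqrt_mul hP₁, ← mul_assoc]
      refine mul_le_mul_of_nonneg_right ?_ (Real.sqrt_nonneg _)
      refine Real.sqrt_le_iff.2 ⟨by positivity, ?_⟩
      rw [mul_pow, Real.sq_sqrt hP₁, r₁]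
  have hP₁' : 0 < P₁ := by linarith
  have hP₂' : 0 < P₂ := by linarith
  set ρ₁ := √(q₁ / P₁)
  set ρ₂ := √(q₂ / P₂)
  set s := √(P₁ * P₂) with hs
  have hspos : 0 < s := Real.sqrt_pos.2 (mul_pos hP₁' hP₂')
  have hss : s ^ 2 = P₁ * P₂ := Real.sq_sqrt (mul_pos hP₁' hP₂').le
  set d₁ := P₁ - q₁ with hd₁
  set d₂ := P₂ - q₂ with hd₂
  have hd₁' : 0 < d₁ := by linarith
  have hd₂' : 0 < d₂ := by linarith
  have g₁ : 1 - ρ₁ ^ 2 = d₁ / P₁ := by rw [eq_div_iff hP₁'.ne']; linarith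
  have g₂ : 1 - ρ₂ ^ 2 = d₂ / P₂ := by rw [eq_div_iff hP₂'.ne']; linarith
  have g₁' : 0 < 1 - ρ₁ ^ 2 := by rw [g₁]; positivity
  have g₂' : 0 < 1 - ρ₂ ^ 2 := by rw [g₂]; positivity
  -- A negative residual covariance is replaced by 0, which keeps ρ ≥ 0 and only weakens the bounds.
  -- The identity κk = κ² lets both signs be treated together.
  set κ := max k 0 with hκ
  have hκ0 : 0 ≤ κ := le_max_right _ _
  have hkκ : k ≤ κ := le_max_left _ _
  have hκk : κ * k = κ ^ 2 := by
    rcases le_total k 0 with h0 | h0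
    · rw [hκ, max_eq_right h0]; ring
    · rw [hκ, max_eq_left h0]; ring
  have hκ2 : κ ^ 2 ≤ d₁ * d₂ := by
    have h1 : (κ - k) ^ 2 = k ^ 2 - κ ^ 2 := by linear_combination (-2) * hκk
    have h2 := sq_nonneg (κ - k)
    have : k₁ * k₂ ≤ d₁ * d₂ := mul_le_mul (by linarith) (by linarith) hk₂ hd₁'.le
    linarith
  have hdet' : corrDet (ρ₁ * ρ₂ + κ / s) ρ₁ ρ₂ = (1 - ρ₁ ^ 2) * (1 - ρ₂ ^ 2) - (κ / s) ^ 2 := by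
    rw [corrDet]; ring
  have hdet : corrDet (ρ₁ * ρ₂ + κ / s) ρ₁ ρ₂ = (d₁ * d₂ - κ ^ 2) / (P₁ * P₂) := by
    rw [hdet', g₁, g₂, div_pow, hss]
    field_simp
  have hdet0 : 0 ≤ corrDet (ρ₁ * ρ₂ + κ / s) ρ₁ ρ₂ := by
    rw [hdet]; exact div_nonneg (by linarith) (by positivity)
  have hρ₁1 : ρ₁ < 1 := (sq_lt_one_iff₀ n₁).1 (by linarith)
  have hρ₂1 : ρ₂ < 1 := (sq_lt_one_iff₀ n₂).1 (by linarith)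
  -- The coefficients κ / d₁ and κ / d₂ are the optimal ones for residual powers d₁, d₂ and
  -- covariance κ. They need no division by k₁ or k₂, which may vanish.
  refine ⟨ρ₁ * ρ₂ + κ / s, ρ₁, ρ₂, κ / d₁, κ / d₂, by positivity, ?_, n₁, hρ₁1, n₂, hρ₂1, hdet0,
    ?_, ?_, ?_, ?_⟩
  -- ρ ≤ 1 follows from the nonnegative determinant, as (1 - ρ₁²)(1 - ρ₂²) ≤ (1 - ρ₁ρ₂)².
  · have h1 : (κ / s) ^ 2 ≤ (1 - ρ₁ * ρ₂) ^ 2 := by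
      have h2 : (1 - ρ₁ ^ 2) * (1 - ρ₂ ^ 2) = (1 - ρ₁ * ρ₂) ^ 2 - (ρ₁ - ρ₂) ^ 2 := by ring
      have h3 := sq_nonneg (ρ₁ - ρ₂)
      rw [hdet'] at hdet0
      linarith
    have h2 := abs_le_of_sq_le_sq h1 (sub_nonneg.2 (mul_le_one₀ hρ₁1.le n₂ hρ₂1.le))
    linarith [le_abs_self (κ / s)]
  · have h1 : 2 * (ρ₁ * ρ₂ + κ / s - ρ₁ * ρ₂) * s = 2 * κ := by
      field_simp; ring
    rw [h1, g₁, g₂, div_mul_cancel₀ _ hP₁'.ne', div_mul_cancel₀ _ hP₂'.ne']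
    linarith
  · rw [hdet, g₁]
    have e1 : (d₁ * d₂ - κ ^ 2) / (P₁ * P₂) * P₂ / (d₁ / P₁) = d₂ - κ ^ 2 / d₁ := by field_simp
    have e2 : k₂ - 2 * (κ / d₁) * k + (κ / d₁) ^ 2 * k₁ =
        k₂ - 2 * (κ * k) / d₁ + κ ^ 2 / d₁ * (k₁ / d₁) := by field_simp
    -- With k₁ ≤ d₁ the error is at most k₂ - 2κ²/d₁ + κ²/d₁, hence at most d₂ - κ²/d₁.
    have e3 : κ ^ 2 / d₁ * (k₁ / d₁) ≤ κ ^ 2 / d₁ * 1 := by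
      gcongr
      exact div_le_one_of_le₀ (by linarith) hd₁'.le
    rw [e1, e2, hκk, mul_div_assoc]
    linarith
  · rw [hdet, g₂]
    have e1 : (d₁ * d₂ - κ ^ 2) / (P₁ * P₂) * P₁ / (d₂ / P₂) = d₁ - κ ^ 2 / d₂ := by field_simp
    have e2 : k₁ - 2 * (κ / d₂) * k + (κ / d₂) ^ 2 * k₂ =
        k₁ - 2 * (κ * k) / d₂ + κ ^ 2 / d₂ * (k₂ / d₂) := by field_simp
    have e3 : κ ^ 2 / d₂ * (k₂ / d₂) ≤ κ ^ 2 / d₂ * 1 := by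
      gcongr
      exact div_le_one_of_le₀ (by linarith) hd₂'.le
    rw [e1, e2, hκk, mul_div_assoc]
    linarith
  · rw [add_mul, div_mul_cancel₀ _ hspos.ne']
    have : √(q₁ * q₂) ≤ ρ₁ * ρ₂ * s := by
      refine Real.sqrt_le_iff.2 ⟨by positivity, le_of_eq ?_⟩
      rw [mul_pow, mul_pow, hss]
      calc q₁ * q₂ = (ρ₁ ^ 2 * P₁) * (ρ₂ ^ 2 * P₂) := by rw [r₁, r₂]
        _ = _ := by ring
    linarith

end CRAN

end

theorem mainTheorem1 (C₁ C₂ C₁₂ C₂₁ P₁ P₂ : ℝ) (hC₁ : 0 ≤ C₁) (hC₂ : 0 ≤ C₂)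
    (hC₁₂ : 0 ≤ C₁₂) (hC₂₁ : 0 ≤ C₂₁) (hP₁ : 0 ≤ P₁) (hP₂ : 0 ≤ P₂)
    (R : ℝ) (hR : CRAN.Achievable C₁ C₂ C₁₂ C₂₁ P₁ P₂ R) :
    ∃ ρ ρ₁ ρ₂ : ℝ, 0 ≤ ρ ∧ ρ ≤ 1 ∧ 0 ≤ ρ₁ ∧ ρ₁ < 1 ∧ 0 ≤ ρ₂ ∧ ρ₂ < 1 ∧
      0 ≤ 1 - ρ ^ 2 - ρ₁ ^ 2 - ρ₂ ^ 2 + 2 * ρ * ρ₁ * ρ₂ ∧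
      ∀ N : ℝ, 0 ≤ N →
        R ≤ C₁ + C₂ ∧
        R ≤ C₁ + C₁₂ + 1 / 2 * Real.logb 2
          ((1 - ρ₁ ^ 2 + (1 - ρ ^ 2 - ρ₁ ^ 2 - ρ₂ ^ 2 + 2 * ρ * ρ₁ * ρ₂) * P₂) / (1 - ρ₁ ^ 2)) ∧
        R ≤ C₂ + C₂₁ + 1 / 2 * Real.logb 2
          ((1 - ρ₂ ^ 2 + (1 - ρ ^ 2 - ρ₁ ^ 2 - ρ₂ ^ 2 + 2 * ρ * ρ₁ * ρ₂) * P₁) / (1 - ρ₂ ^ 2)) ∧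
        R ≤ 1 / 2 * Real.logb 2 (1 + P₁ + P₂ + 2 * ρ * √(P₁ * P₂)) ∧
        R ≤ C₁₂ + C₂₁ + 1 / 2 * Real.logb 2
          (1 + (1 - ρ₁ ^ 2) * P₁ + (1 - ρ₂ ^ 2) * P₂ + 2 * (ρ - ρ₁ * ρ₂) * √(P₁ * P₂)) ∧
        R ≤ 1 / 2 * (C₁ + C₂ + C₁₂ + C₂₁ + 1 / 2 * Real.logb 2
          (CRAN.varphi ρ ρ₁ ρ₂ P₁ P₂ * CRAN.phi₁ N ρ ρ₁ ρ₂ P₂ * CRAN.phi₂ N ρ ρ₁ ρ₂ P₁ /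
            ((1 + N) * (1 - ρ₁ ^ 2) * (1 - ρ₂ ^ 2) * (N + CRAN.varphi ρ ρ₁ ρ₂ P₁ P₂)))) := by
  obtain ⟨k₁, k₂, k, q₁, q₂, hF⟩ := hR.feasible
  obtain ⟨ρ, ρ₁, ρ₂, a, b, h0, h1, h2, h3, h4, h5, h6, hs, ha, hb, hf⟩ := hF.exists_correlations
  exact ⟨ρ, ρ₁, ρ₂, h0, h1, h2, h3, h4, h5, h6,
    hF.bounds (by nlinarith) (by nlinarith) hs ha hb hf⟩
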